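/- Let $R$ be a (unital, associative, not necessarily commutative) ring which is free as a $\mathbb{Z}$-module, of finite or infinite rank. Let $$\mathcal{G}_\infty^{\mathbb{Q}}(R)=\bigotimes_{i\ge 1}U(\mathbb{Q}\otimes_{\mathbb Z} R_i),$$ where $U(\mathbb{Q}\otimes R_i)$ is a copy of the universal enveloping algebra of $\mathbb{Q}\otimes R$ with its commutator bracket, and the tensor product is spanned by the pure tensors almost all of whose factors are $1$. For $x\in\mathbb{Q}\otimes R$ let $T_l(x)\in\mathcal{G}_\infty^{\mathbb{Q}}(R)$ be the image of $x$ in the $l$-th tensor factor. For a $\mathbb{Z}$-basis $I$ of $R$, let $\mathcal{P}^I$ be the set of functions $\vec\lambda$ from $I$ to the set of partitions with $\sum_{U\in I}|\vec\lambda(U)|<\infty$. For each $U\in I$ take a countable set of variables $\mathbf{x}_U$, and for a symmetric function $f$ write $f^{(U)}=f(\mathbf{x}_U)$; let $s_\lambda$ and $p_l$ denote the Schur functions and the power sums. Consider the equality of formal power series in all these variables, with coefficients in $\mathcal{G}_\infty^{\mathbb{Q}}(R)$, $$\sum_{\vec\lambda\in\mathcal{P}^I}\Big(\prod_{U\in I}s_{\vec\lambda(U)}^{(U)}\Big)\otimes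 Z_{\vec\lambda}=\prod_{l=1}^{\infty}\exp\Big(T_l\Big(\log\Big(1+\sum_{U\in I}p_l^{(U)}\,U\Big)\Big)\Big),$$ where $T_l$ is applied coefficientwise. Theorem. For every $\mathbb{Z}$-basis $I$ of $R$ there is exactly one family $(Z_{\vec\lambda}(I))_{\vec\lambda\in\mathcal{P}^I}$ of elements of $\mathcal{G}_\infty^{\mathbb{Q}}(R)$ satisfying this equality, and its $\mathbb{Z}$-span $\mathcal{G}_\infty^{\mathbb{Z}}(R)\subseteq\mathcal{G}_\infty^{\mathbb{Q}}(R)$ does not depend on $I$: for any two $\mathbb{Z}$-bases $I$ and $I'$ of $R$, $$\operatorname{span}_{\mathbb{Z}}\{Z_{\vec\lambda}(I):\vec\lambda\in\mathcal{P}^{I}\}=\operatorname{span}_{\mathbb{Z}}\{Z_{\vec\lambda}(I'):\vec\lambda\in\mathcal{P}^{I'}\}.$$ -/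

import Mathlib

open scoped TensorProduct

noncomputable section

namespace LimitGrothendieck

universe u v

/-! ### Symmetric functions -/

/-- The complete symmetric function `h_n = ∑_{i₁ ≤ ⋯ ≤ iₙ} x_{i₁} ⋯ x_{iₙ}`: the sum of all monomials
of degree `n` in the variables `x_0, x_1, …`. -/
def completeSymm (n : ℕ) : MvPowerSeries ℕ ℤ :=
  fun α => if α.degree = n then 1 else 0

open Classical in
/-- The power sum `p_l = ∑_i x_i ^ l`, for `l ≥ 1`. -/
def powerSum (l : ℕ+) : MvPowerSeries ℕ ℤ :=
  fun α => if ∃ i, α = Finsupp.single i (l : ℕ) then 1 else 0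

/-- The Schur function `s_μ`, given by the Jacobi-Trudi determinant `det (h_{μ_i - i + j})`
(with `h_k = 0` for `k < 0`), whose size is the number of rows of the Young diagram `μ`. -/
def schur (μ : YoungDiagram) : MvPowerSeries ℕ ℤ :=
  Matrix.det (Matrix.of fun i j : Fin (μ.colLen 0) =>
    if (i : ℕ) ≤ μ.rowLen i + j then completeSymm (μ.rowLen i + j - i) else 0)

/-- For a symmetric function `f`, the function `f^{(U)} = f(𝐱_U)` in the set of variables
`𝐱_U = {x_{U,0}, x_{U,1}, …}`. The functions symmetric in each of the sets `𝐱_U`, `U ∈ ι`, are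
viewed as power series in all the variables `x_{U,i}`. -/
def inVars {ι : Type v} (U : ι) (f : MvPowerSeries ℕ ℤ) : MvPowerSeries (ι × ℕ) ℤ :=
  MvPowerSeries.rename (Function.Embedding.sectR U ℕ) f

/-- Multipartitions indexed by `ι`: functions `ι → {partitions}` of finite total size
(partitions are given by their Young diagrams). -/
structure Multipartition (ι : Type v) where
  part : ι → YoungDiagram
  finite_support : (Function.support fun U => (part U).card).Finite

/-- `∏_U s_{lam(U)}^{(U)}`. The factors for the empty partition are equal to `1` and are left out. -/
def schurProd {ι : Type v} (lam : Multipartition ι) : MvPowerSeries (ι × ℕ) ℤ :=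
  ∏ U ∈ lam.finite_support.toFinset, inVars U (schur (lam.part U))

/-! ### The rational algebra -/

/-- The Lie ring structure on `ℚ ⊗ R` given by the commutators `x * y - y * x`. -/
abbrev commutatorLieRing (R : Type u) [Ring R] : LieRing (ℚ ⊗[ℤ] R) :=
  LieRing.ofAssociativeRing

/-- `U(ℚ ⊗ R)`, the universal enveloping algebra of `ℚ ⊗ R` with its commutator bracket. -/
abbrev Env (R : Type u) [Ring R] : Type u :=
  letI := commutatorLieRing R
  UniversalEnvelopingAlgebra ℚ (ℚ ⊗[ℤ] R)

/-- The canonical map `ℚ ⊗ R → U(ℚ ⊗ R)`. -/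
def envMap (R : Type u) [Ring R] : (ℚ ⊗[ℤ] R) →ₗ[ℚ] Env R :=
  letI := commutatorLieRing R
  letI : LieRing (Env R) := LieRing.ofAssociativeRing
  (UniversalEnvelopingAlgebra.ι ℚ (L := ℚ ⊗[ℤ] R)).toLinearMap

/-- The algebra `⨂_{i ≥ 1} U(ℚ ⊗ R_i)`, with one copy `R_i` of `R` for each `i ≥ 1`. As usual for
infinite tensor products of algebras, it is spanned by the pure tensors with all but finitely many
factors equal to `1`, that is, it is generated by the images of the tensor factors. -/
def rationalAlgebra (R : Type u) [Ring R] : Subalgebra ℚ (⨂[ℚ] _ : ℕ+, Env R) :=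
  ⨆ i : ℕ+, (PiTensorProduct.singleAlgHom (R := ℚ) (A := fun _ : ℕ+ => Env R) i).range

/-- The underlying type of the algebra `⨂_{i ≥ 1} U(ℚ ⊗ R_i)`. -/
abbrev GQ (R : Type u) [Ring R] : Type u := rationalAlgebra R

/-- The inclusion of the `l`-th tensor factor into `⨂_{i ≥ 1} U(ℚ ⊗ R_i)`. -/
def factorMap (R : Type u) [Ring R] (l : ℕ+) : Env R →ₐ[ℚ] GQ R :=
  (PiTensorProduct.singleAlgHom (R := ℚ) (A := fun _ : ℕ+ => Env R) l).codRestrict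
    (rationalAlgebra R) fun x => le_iSup (fun i : ℕ+ =>
      (PiTensorProduct.singleAlgHom (R := ℚ) (A := fun _ : ℕ+ => Env R) i).range) l ⟨x, rfl⟩

/-- `T_l : ℚ ⊗ R → ⨂_{i ≥ 1} U(ℚ ⊗ R_i)`, the canonical map to the `l`-th tensor factor. -/
def T (R : Type u) [Ring R] (l : ℕ+) : (ℚ ⊗[ℤ] R) →ₗ[ℚ] GQ R :=
  (factorMap R l).toLinearMap ∘ₗ envMap R

/-! ### Generating functions

Power series in the commuting variables `x_{U,i}` with coefficients in a possibly noncommutative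
`ℚ`-algebra. -/

/-- The series `f(y) = ∑_n f_n y^n`, for a series `f` in one variable and a power series `y` without
constant term. As the coefficient of a monomial of degree `d` in `y^n` vanishes for `n > d`, only
the powers with `n ≤ d` are needed for it. -/
def evalSeries {σ : Type v} {A : Type u} [Ring A] [Algebra ℚ A] (f : PowerSeries ℚ)
    (y : MvPowerSeries σ A) : MvPowerSeries σ A :=
  fun α => ∑ n ∈ Finset.range (α.degree + 1),
    PowerSeries.coeff n f • MvPowerSeries.coeff α (y ^ n)

/-- Application of a linear map to the coefficients of a power series. -/
def mapCoeff {σ : Type v} {A B : Type u} [Ring A] [Algebra ℚ A] [Ring B] [Algebra ℚ B]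
    (L : A →ₗ[ℚ] B) (y : MvPowerSeries σ A) : MvPowerSeries σ B :=
  fun α => L (MvPowerSeries.coeff α y)

variable {R : Type u} [Ring R] {ι : Type v}

/-- `∑_{U} p_l^{(U)} U`, the sum being over the elements `U` of the basis `b`. At most one summand
contributes to the coefficient of a given monomial. -/
def powerSumElt (b : Module.Basis ι ℤ R) (l : ℕ+) : MvPowerSeries (ι × ℕ) (ℚ ⊗[ℤ] R) :=
  fun α => ∑ᶠ U : ι, MvPowerSeries.coeff α (inVars U (powerSum l)) • ((1 : ℚ) ⊗ₜ[ℤ] b U)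

/-- `exp (T_l (log (1 + ∑_U p_l^{(U)} U)))`. Note that `PowerSeries.log` is the series
`log (1 + X)`. -/
def genFactor (b : Module.Basis ι ℤ R) (l : ℕ+) : MvPowerSeries (ι × ℕ) (GQ R) :=
  evalSeries (PowerSeries.exp ℚ)
    (mapCoeff (T R l) (evalSeries (PowerSeries.log ℚ) (powerSumElt b l)))

/-- `∏_{l ≥ 1} exp (T_l (log (1 + ∑_U p_l^{(U)} U)))`. The `l`-th factor is `1` plus terms of degree
at least `l`, so that only the factors with `1 ≤ l ≤ d` affect the coefficient of a monomial of
degree `d`. The factors commute; they are multiplied in the order of increasing `l`. -/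
def genFun (b : Module.Basis ι ℤ R) : MvPowerSeries (ι × ℕ) (GQ R) :=
  fun α => MvPowerSeries.coeff α
    ((List.range α.degree).map fun k => genFactor b k.succPNat).prod

/-- The defining equality of the family `Z_lam`:
`∑_lam (∏_U s_{lam(U)}^{(U)}) ⊗ Z_lam = ∏_{l ≥ 1} exp (T_l (log (1 + ∑_U p_l^{(U)} U)))`,
stated for the coefficient of each monomial in the variables `x_{U,i}`. Since `s_μ` is homogeneous
of degree `|μ|`, only finitely many `lam` contribute to each coefficient. -/
def IsZFamily (b : Module.Basis ι ℤ R) (Z : Multipartition ι → GQ R) : Prop :=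
  ∀ α : ι × ℕ →₀ ℕ,
    ∑ᶠ lam : Multipartition ι, MvPowerSeries.coeff α (schurProd lam) • Z lam =
      MvPowerSeries.coeff α (genFun b)

/-- The `ℤ`-span of a family `Z_lam`. -/
def integralForm (Z : Multipartition ι → GQ R) : Submodule ℤ (GQ R) :=
  Submodule.span ℤ (Set.range Z)

end LimitGrothendieck

end

/-! Both spans are compared with `coeffGroup b`, the group generated by all coefficients of the
generating function.

The span is this group by triangularity. Expanding Jacobi-Trudi determinants in the first variable
shows that `s_μ` has leading monomial `x^μ` with coefficient 1 in the lexicographic order. So the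
defining equality, read at leading exponents, is a unitriangular integral system: it has exactly one
solution, lying in the group generated by the right-hand sides (`exists_solution`,
`solution_unique`, `solution_mem`). The other monomials add nothing, both sides being symmetric in
each set of variables (`isZFamily_iff`).

The group does not depend on the basis because, for any family `r` in `R`, the series built from `∑
x_s ^ l r_s` has all its coefficients in `coeffGroup b` (`coeff_mem_coeffGroup`). If each `r_s` is a
sum of basis elements, the series arises from the original one by identifying variables, so its
coefficients are finite sums of the original coefficients. For differences `x_s - y_s`, each
coefficient of the series of `x_s + n y_s` is a polynomial in `n`, possibly with denominators. Its
value at `n = -1` is still an integral combination of its values at natural numbers, since high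
finite differences vanish. -/

open scoped TensorProduct

noncomputable section

namespace LimitGrothendieck

universe u v

variable {R : Type u} [Ring R] {ι : Type v}

/-! ### Substitution of variables in power series -/

/-- A finite-to-one correspondence between monomials in the variables `σ` and monomials in the
variables `τ`, compatible with products. It turns a power series in the variables `τ` into one in
the variables `σ`, as does a substitution of variables or of zero for variables. -/
structure MonomialTransfer (σ τ : Type*) where
  fiber : (σ →₀ ℕ) → Finset (τ →₀ ℕ)
  degree_eq : ∀ {β α}, α ∈ fiber β → α.degree = β.degree
  zero_mem : 0 ∈ fiber 0
  add_mem : ∀ {β₁ β₂ α₁ α₂}, α₁ ∈ fiber β₁ → α₂ ∈ fiber β₂ → α₁ + α₂ ∈ fiber (β₁ + β₂)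
  exists_of_add_mem : ∀ {β α₁ α₂}, α₁ + α₂ ∈ fiber β →
    ∃ β₁ β₂, β₁ + β₂ = β ∧ α₁ ∈ fiber β₁ ∧ α₂ ∈ fiber β₂
  eq_of_mem : ∀ {β β' α}, α ∈ fiber β → α ∈ fiber β' → β = β'

namespace MonomialTransfer

variable {σ τ : Type*} (K : MonomialTransfer σ τ) {A : Type*} [Ring A]

/-- The map on power series given by a transfer of monomials. -/
def homFun (F : MvPowerSeries τ A) : MvPowerSeries σ A :=
  fun β => ∑ α ∈ K.fiber β, MvPowerSeries.coeff α F

lemma coeff_homFun (F : MvPowerSeries τ A) (β : σ →₀ ℕ) :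
    MvPowerSeries.coeff β (K.homFun F) = ∑ α ∈ K.fiber β, MvPowerSeries.coeff α F := rfl

lemma homFun_one : K.homFun (1 : MvPowerSeries τ A) = 1 := by
  classical
  ext β
  rw [coeff_homFun, MvPowerSeries.coeff_one]
  simp only [MvPowerSeries.coeff_one, Finset.sum_ite_eq']
  refine if_congr ⟨fun h => ?_, ?_⟩ rfl rfl
  · have := K.degree_eq h
    rw [map_zero] at this
    exact (Finsupp.degree_eq_zero_iff β).1 this.symm
  · rintro rfl
    exact K.zero_mem

/-- Splittings of the monomials over `β` correspond to splittings of `β` with a monomial over each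
part: `exists_of_add_mem` gives surjectivity, `eq_of_mem` injectivity. The order of the factors is
kept, so the coefficients need not commute. -/
lemma homFun_mul (F G : MvPowerSeries τ A) : K.homFun (F * G) = K.homFun F * K.homFun G := by
  classical
  ext β
  simp only [MvPowerSeries.coeff_mul, coeff_homFun, Finset.sum_mul_sum]
  simp only [← Finset.sum_product', Finset.sum_sigma']
  symm
  refine Finset.sum_bij (fun x _ => ⟨x.2.1 + x.2.2, x.2⟩) ?_ ?_ ?_ ?_
  · rintro ⟨⟨β₁, β₂⟩, α₁, α₂⟩ h
    simp only [Finset.mem_sigma, Finset.HasAntidiagonal.mem_antidiagonal, Finset.mem_product] at h ⊢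
    obtain ⟨rfl, h₁, h₂⟩ := h
    exact ⟨K.add_mem h₁ h₂, trivial⟩
  · rintro ⟨⟨β₁, β₂⟩, α₁, α₂⟩ h ⟨⟨γ₁, γ₂⟩, α₁', α₂'⟩ h' e
    simp only [Finset.mem_sigma, Finset.HasAntidiagonal.mem_antidiagonal, Finset.mem_product] at h h'
    simp only [Sigma.mk.injEq, heq_eq_eq, Prod.mk.injEq] at e
    obtain ⟨-, rfl, rfl⟩ := e
    rw [K.eq_of_mem h.2.1 h'.2.1, K.eq_of_mem h.2.2 h'.2.2]
  · rintro ⟨α, α₁, α₂⟩ h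
    simp only [Finset.mem_sigma, Finset.HasAntidiagonal.mem_antidiagonal] at h
    obtain ⟨h, rfl⟩ := h
    obtain ⟨β₁, β₂, rfl, h₁, h₂⟩ := K.exists_of_add_mem h
    exact ⟨⟨(β₁, β₂), α₁, α₂⟩, by simp [h₁, h₂], rfl⟩
  · intros; rfl

/-- The ring homomorphism on power series given by a transfer of monomials. -/
def hom (A : Type*) [Ring A] : MvPowerSeries τ A →+* MvPowerSeries σ A where
  toFun := K.homFun
  map_zero' := by ext; simp [coeff_homFun]
  map_add' F G := by ext; simp [coeff_homFun, Finset.sum_add_distrib]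
  map_one' := K.homFun_one
  map_mul' := K.homFun_mul

lemma coeff_hom (F : MvPowerSeries τ A) (β : σ →₀ ℕ) :
    MvPowerSeries.coeff β (K.hom A F) = ∑ α ∈ K.fiber β, MvPowerSeries.coeff α F := rfl

open Classical in
/-- The transfer setting to zero the variables outside the range of an embedding. -/
def ofEmbedding (j : σ ↪ τ) : MonomialTransfer σ τ where
  fiber β := {β.embDomain j}
  degree_eq h := by
    rw [Finset.mem_singleton.1 h, Finsupp.embDomain_eq_mapDomain, Finsupp.degree_mapDomain]
  zero_mem := by simp
  add_mem h₁ h₂ := by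
    rw [Finset.mem_singleton] at *
    rw [h₁, h₂, Finsupp.embDomain_eq_mapDomain, Finsupp.embDomain_eq_mapDomain,
      Finsupp.embDomain_eq_mapDomain, Finsupp.mapDomain_add]
  exists_of_add_mem {β α₁ α₂} h := by
    have h' : (α₁, α₂) ∈ Finset.HasAntidiagonal.antidiagonal (β.embDomain j) := by simpa using h
    rw [← Finsupp.image_prodMap_embDomain_antidiagonal, Finset.mem_image] at h'
    obtain ⟨⟨β₁, β₂⟩, hβ, e⟩ := h'
    simp only [Prod.map_apply, Prod.mk.injEq] at e
    exact ⟨β₁, β₂, by simpa using hβ, by simp [e.1], by simp [e.2]⟩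
  eq_of_mem h h' := by
    rw [Finset.mem_singleton] at *
    exact Finsupp.embDomain_injective j (h.symm.trans h')

/-- The transfer substituting the variable `q t` for the variable `t`. -/
def ofMap [Finite τ] (q : τ → σ) : MonomialTransfer σ τ where
  fiber β := (Filter.TendstoCofinite.finite_preimage_singleton
    (Finsupp.mapDomain (M := ℕ) q) β).toFinset
  degree_eq h := by
    simp only [Set.Finite.mem_toFinset, Set.mem_preimage, Set.mem_singleton_iff] at h
    rw [← h, Finsupp.degree_mapDomain]
  zero_mem := by simp
  add_mem h₁ h₂ := by
    simp only [Set.Finite.mem_toFinset, Set.mem_preimage, Set.mem_singleton_iff] at *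
    rw [Finsupp.mapDomain_add, h₁, h₂]
  exists_of_add_mem {β α₁ α₂} h := by
    simp only [Set.Finite.mem_toFinset, Set.mem_preimage, Set.mem_singleton_iff] at *
    exact ⟨_, _, by rw [← h, Finsupp.mapDomain_add], rfl, rfl⟩
  eq_of_mem h h' := by
    simp only [Set.Finite.mem_toFinset, Set.mem_preimage, Set.mem_singleton_iff] at *
    exact h.symm.trans h'

lemma mem_ofMap [Finite τ] {q : τ → σ} {β : σ →₀ ℕ} {α : τ →₀ ℕ} :
    α ∈ (ofMap q).fiber β ↔ α.mapDomain q = β := by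
  simp [ofMap]

end MonomialTransfer

/-! ### Generating functions with arbitrary weights -/

section Transfer

variable {σ τ : Type*} (K : MonomialTransfer σ τ) {A B : Type u} [Ring A] [Algebra ℚ A]
  [Ring B] [Algebra ℚ B]

lemma coeff_evalSeries {σ : Type*} (f : PowerSeries ℚ) (y : MvPowerSeries σ A) (α : σ →₀ ℕ) :
    MvPowerSeries.coeff α (evalSeries f y) = ∑ n ∈ Finset.range (α.degree + 1),
      PowerSeries.coeff n f • MvPowerSeries.coeff α (y ^ n) := rfl

lemma coeff_mapCoeff {σ : Type*} (L : A →ₗ[ℚ] B) (y : MvPowerSeries σ A) (α : σ →₀ ℕ) :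
    MvPowerSeries.coeff α (mapCoeff L y) = L (MvPowerSeries.coeff α y) := rfl

/-- A transfer preserves degrees, so the truncation in `evalSeries` is the same on both sides. -/
lemma hom_evalSeries (f : PowerSeries ℚ) (y : MvPowerSeries τ A) :
    K.hom A (evalSeries f y) = evalSeries f (K.hom A y) := by
  ext β
  simp only [K.coeff_hom, coeff_evalSeries]
  rw [Finset.sum_congr rfl fun α hα => by rw [K.degree_eq hα], Finset.sum_comm]
  refine Finset.sum_congr rfl fun n _ => ?_
  rw [← Finset.smul_sum, ← map_pow, K.coeff_hom]

lemma hom_mapCoeff (L : A →ₗ[ℚ] B) (y : MvPowerSeries τ A) :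
    K.hom B (mapCoeff L y) = mapCoeff L (K.hom A y) := by
  ext β
  simp only [K.coeff_hom, coeff_mapCoeff, map_sum]

open Classical in
/-- The series `∑_t x_t ^ l u_t`. -/
def weightedPowerSum {σ : Type*} {A : Type*} [AddCommMonoid A] (u : σ → A) (l : ℕ+) :
    MvPowerSeries σ A :=
  fun α => ∑ᶠ t, if α = Finsupp.single t (l : ℕ) then u t else 0

/-- `exp (T_l (log (1 + ∑_t x_t ^ l u_t)))`. -/
def weightedFactor (u : σ → ℚ ⊗[ℤ] R) (l : ℕ+) : MvPowerSeries σ (GQ R) :=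
  evalSeries (PowerSeries.exp ℚ)
    (mapCoeff (T R l) (evalSeries (PowerSeries.log ℚ) (weightedPowerSum u l)))

/-- `∏_{l ≥ 1} exp (T_l (log (1 + ∑_t x_t ^ l u_t)))`. -/
def weightedGenFun (u : σ → ℚ ⊗[ℤ] R) : MvPowerSeries σ (GQ R) :=
  fun α => MvPowerSeries.coeff α
    ((List.range α.degree).map fun k => weightedFactor u k.succPNat).prod

lemma coeff_weightedGenFun (u : σ → ℚ ⊗[ℤ] R) (α : σ →₀ ℕ) :
    MvPowerSeries.coeff α (weightedGenFun u) = MvPowerSeries.coeff α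
      ((List.range α.degree).map fun k => weightedFactor u k.succPNat).prod := rfl

lemma coeff_weightedPowerSum {A : Type*} [Ring A] (u : σ → A) (l : ℕ+) (α : σ →₀ ℕ)
    [DecidableEq (σ →₀ ℕ)] :
    MvPowerSeries.coeff α (weightedPowerSum u l) =
      ∑ᶠ t, if α = Finsupp.single t (l : ℕ) then u t else 0 :=
  finsum_congr fun _ => by congr

/-- A transfer commutes with `log`, `T_l`, `exp` and products, and it respects the degree at which
the infinite product is cut off; only the innermost series has to be compared. -/
lemma coeff_weightedGenFun_of_transfer {u : τ → ℚ ⊗[ℤ] R} {w : σ → ℚ ⊗[ℤ] R}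
    (h : ∀ l, K.hom _ (weightedPowerSum u l) = weightedPowerSum w l) (β : σ →₀ ℕ) :
    MvPowerSeries.coeff β (weightedGenFun w) =
      ∑ α ∈ K.fiber β, MvPowerSeries.coeff α (weightedGenFun u) := by
  have hf : ∀ l, K.hom _ (weightedFactor u l) = weightedFactor w l := fun l => by
    rw [weightedFactor, hom_evalSeries, hom_mapCoeff, hom_evalSeries, h, weightedFactor]
  simp only [coeff_weightedGenFun]
  rw [Finset.sum_congr rfl fun α hα => by rw [K.degree_eq hα], ← K.coeff_hom, map_list_prod (K.hom _), List.map_map]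
  simp only [Function.comp_def, hf]

lemma weightedPowerSum_single (u : σ → ℚ ⊗[ℤ] R) (l : ℕ+) (t : σ) :
    MvPowerSeries.coeff (Finsupp.single t (l : ℕ)) (weightedPowerSum u l) = u t := by
  classical
  rw [coeff_weightedPowerSum, finsum_eq_single _ t]
  · simp
  · intro s hs
    rw [if_neg]
    intro h
    exact hs ((Finsupp.single_left_inj l.ne_zero).1 h).symm

lemma weightedPowerSum_eq_zero (u : σ → ℚ ⊗[ℤ] R) (l : ℕ+) {α : σ →₀ ℕ}
    (h : ∀ t, α ≠ Finsupp.single t (l : ℕ)) : 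
    MvPowerSeries.coeff α (weightedPowerSum u l) = 0 := by
  classical
  rw [coeff_weightedPowerSum, finsum_eq_zero_of_forall_eq_zero]
  intro t
  rw [if_neg (h t)]

lemma coeff_weightedGenFun_comp (u : τ → ℚ ⊗[ℤ] R) (j : σ ↪ τ) (β : σ →₀ ℕ) :
    MvPowerSeries.coeff β (weightedGenFun (u ∘ j)) =
      MvPowerSeries.coeff (β.embDomain j) (weightedGenFun u) := by
  rw [coeff_weightedGenFun_of_transfer (MonomialTransfer.ofEmbedding j) (u := u)]
  · exact Finset.sum_singleton _ _
  intro l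
  ext γ
  rw [MonomialTransfer.coeff_hom]
  refine (Finset.sum_singleton _ _).trans ?_
  by_cases h : ∃ s, γ = Finsupp.single s (l : ℕ)
  · obtain ⟨s, rfl⟩ := h
    rw [Finsupp.embDomain_single, weightedPowerSum_single, weightedPowerSum_single]
    rfl
  · rw [weightedPowerSum_eq_zero _ _ (not_exists.1 h), weightedPowerSum_eq_zero]
    intro t ht
    have ht' : t ∈ Set.range j := by
      by_contra hn
      have := Finsupp.embDomain_of_notMem_range j γ t hn
      rw [ht] at this
      simp at this
    obtain ⟨s, rfl⟩ := ht'
    rw [← Finsupp.embDomain_single] at ht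
    exact h ⟨s, Finsupp.embDomain_injective j ht⟩

/-- Putting `x_{q t}` for `x_t` turns `∑ x_t ^ l u_t` into a series whose weights are the sums of
`u` over the fibers of `q`. This is how sums of weights are handled without leaving the integral
span of the coefficients. -/
lemma coeff_weightedGenFun_fiber_sum [Fintype τ] [Fintype σ] [DecidableEq σ]
    (u : τ → ℚ ⊗[ℤ] R) (q : τ → σ) (β : σ →₀ ℕ) :
    MvPowerSeries.coeff β (weightedGenFun fun s => ∑ t with q t = s, u t) =
      ∑ α ∈ (MonomialTransfer.ofMap q).fiber β, MvPowerSeries.coeff α (weightedGenFun u) := by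
  classical
  refine coeff_weightedGenFun_of_transfer _ (fun l => ?_) β
  ext γ
  rw [MonomialTransfer.coeff_hom]
  simp only [coeff_weightedPowerSum, finsum_eq_sum_of_fintype]
  rw [Finset.sum_comm]
  have e : ∀ s, (if γ = Finsupp.single s (l : ℕ) then ∑ t with q t = s, u t else 0) =
      ∑ t, if q t = s then (if γ = Finsupp.single (q t) (l : ℕ) then u t else 0) else 0 := by
    intro s
    rw [Finset.sum_filter]
    split_ifs with h
    · refine Finset.sum_congr rfl fun t _ => ?_
      split_ifs with h₁ h₂
      · rfl
      · exact absurd (h₁ ▸ h) h₂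
      · rfl
    · refine (Finset.sum_eq_zero fun t _ => ?_).symm
      split_ifs with h₁ h₂
      · exact absurd (h₁ ▸ h₂) h
      · rfl
      · rfl
  simp only [e]
  rw [Finset.sum_comm (s := Finset.univ) (t := Finset.univ)]
  refine Finset.sum_congr rfl fun t _ => ?_
  simp only [Finset.sum_ite_eq', Finset.sum_ite_eq, Finset.mem_univ, if_true]
  simp [MonomialTransfer.mem_ofMap, Finsupp.mapDomain_single, eq_comm]

end Transfer

/-! ### Polynomial dependence on an integer -/

/-- The polynomial functions on `ℤ` with values in an abelian group. -/
def polyFun (A : Type*) [AddCommGroup A] : AddSubgroup (ℤ → A) :=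
  AddSubgroup.closure {g | ∃ (k : ℕ) (a : A), g = fun n => n ^ k • a}

section PolyFun

variable {A B : Type*}

lemma pow_smul_mem_polyFun [AddCommGroup A] (k : ℕ) (a : A) :
    (fun n : ℤ => n ^ k • a) ∈ polyFun A :=
  AddSubgroup.subset_closure ⟨k, a, rfl⟩

lemma const_mem_polyFun [AddCommGroup A] (a : A) : (fun _ : ℤ => a) ∈ polyFun A := by
  simpa using pow_smul_mem_polyFun 0 a

lemma sum_mem_polyFun [AddCommGroup A] {κ : Type*} {s : Finset κ} {g : κ → ℤ → A}
    (h : ∀ i ∈ s, g i ∈ polyFun A) : (fun n => ∑ i ∈ s, g i n) ∈ polyFun A := by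
  rw [← Finset.sum_fn]
  exact sum_mem h

lemma map_mem_polyFun [AddCommGroup A] [AddCommGroup B] (L : A →+ B) {g : ℤ → A}
    (hg : g ∈ polyFun A) : (fun n => L (g n)) ∈ polyFun B := by
  induction hg using AddSubgroup.closure_induction with
  | mem g h =>
    obtain ⟨k, a, rfl⟩ := h
    simpa using pow_smul_mem_polyFun k (L a)
  | zero => simpa using const_mem_polyFun (0 : B)
  | add f g _ _ hf hg =>
    simp only [Pi.add_apply, map_add]
    exact add_mem hf hg
  | neg f _ hf =>
    simp only [Pi.neg_apply, map_neg]
    exact neg_mem hf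

lemma mul_mem_polyFun [Ring A] {f g : ℤ → A} (hf : f ∈ polyFun A) (hg : g ∈ polyFun A) :
    (fun n => f n * g n) ∈ polyFun A := by
  change f * g ∈ polyFun A
  induction hf, hg using AddSubgroup.closure_induction₂ with
  | mem f g hf hg =>
    obtain ⟨k, a, rfl⟩ := hf
    obtain ⟨l, c, rfl⟩ := hg
    convert pow_smul_mem_polyFun (k + l) (a * c) using 1
    ext n
    simp only [Pi.mul_apply, smul_mul_assoc, mul_smul_comm, smul_smul, pow_add,
      mul_comm]
  | zero_left => simp
  | zero_right => simp
  | add_left f g k _ _ _ hf hg => simpa [add_mul] using add_mem hf hg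
  | add_right f g k _ _ _ hf hg => simpa [mul_add] using add_mem hf hg
  | neg_left f k _ _ hf => simpa using neg_mem hf
  | neg_right f k _ _ hf => simpa using neg_mem hf

lemma exists_fwdDiff_iter_eq_zero [AddCommGroup A] {g : ℤ → A} (hg : g ∈ polyFun A) :
    ∃ D : ℕ, ∀ d ≥ D, (fwdDiff (1 : ℤ))^[d] g = 0 := by
  induction hg using AddSubgroup.closure_induction with
  | mem g h =>
    obtain ⟨k, a, rfl⟩ := h
    have key : ∀ (d : ℕ) (p : ℤ → ℤ), (fwdDiff (1 : ℤ))^[d] (fun n => p n • a) =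
        fun n => ((fwdDiff (1 : ℤ))^[d] p) n • a := by
      intro d
      induction d with
      | zero => intro p; rfl
      | succ d ih =>
        intro p
        rw [Function.iterate_succ_apply, Function.iterate_succ_apply, ← ih]
        congr 1
        ext n
        simp [fwdDiff, sub_smul]
    refine ⟨k + 1, fun d hd => ?_⟩
    rw [key, fwdDiff_iter_pow_eq_zero_of_lt (R := ℤ) hd]
    simp
    rfl
  | zero =>
    refine ⟨0, fun d _ => ?_⟩
    have := fwdDiff_iter_const_smul (h := (1 : ℤ)) (0 : ℤ) (0 : ℤ → A) d
    simpa using this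
  | add f g _ _ hf hg =>
    obtain ⟨D, hD⟩ := hf
    obtain ⟨E, hE⟩ := hg
    refine ⟨max D E, fun d hd => ?_⟩
    rw [fwdDiff_iter_add, hD d (le_of_max_le_left hd), hE d (le_of_max_le_right hd), add_zero]
  | neg f _ hf =>
    obtain ⟨D, hD⟩ := hf
    refine ⟨D, fun d hd => ?_⟩
    have := fwdDiff_iter_const_smul (h := (1 : ℤ)) (-1 : ℤ) f d
    rw [hD d hd] at this
    simpa using this

/-- A vanishing iterated difference based at `-1` is an integral relation in which `g (-1)` has
coefficient `±1`, so denominators in the polynomial do no harm. -/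
lemma apply_neg_one_mem_of_polyFun [AddCommGroup A] {g : ℤ → A} (hg : g ∈ polyFun A)
    (N : AddSubgroup A) (h : ∀ n : ℕ, g n ∈ N) : g (-1) ∈ N := by
  obtain ⟨D, hD⟩ := exists_fwdDiff_iter_eq_zero hg
  have e := congrFun (hD D le_rfl) (-1)
  -- The summand split off is `(-1) ^ D • g (-1)`; the others involve only `g 0, …, g (D - 1)`.
  rw [fwdDiff_iter_eq_sum_shift, Finset.sum_range_succ'] at e
  simp only [Pi.zero_apply, Nat.choose_zero_right, zero_smul, add_zero, tsub_zero] at e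
  have h₁ : ((-1 : ℤ) ^ D * ((1 : ℕ) : ℤ)) • g (-1) ∈ N := by
    rw [← neg_eq_iff_add_eq_zero] at e
    rw [← e]
    refine neg_mem (sum_mem fun k _ => zsmul_mem ?_ _)
    have := h k
    convert this using 2
    simp
  have h₂ := zsmul_mem h₁ ((-1) ^ D)
  rwa [smul_smul, Nat.cast_one, mul_one, ← mul_pow, neg_one_mul, neg_neg, one_pow, one_smul] at h₂

end PolyFun

/-- A family of power series depending polynomially on an integer. -/
def PolySeries {σ A : Type*} [Ring A] (F : ℤ → MvPowerSeries σ A) : Prop :=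
  ∀ α, (fun n => MvPowerSeries.coeff α (F n)) ∈ polyFun A

namespace PolySeries

variable {σ : Type*} {A B : Type u} [Ring A] [Ring B]

lemma one : PolySeries fun _ => (1 : MvPowerSeries σ A) := fun _ => const_mem_polyFun _

lemma mul {F G : ℤ → MvPowerSeries σ A} (hF : PolySeries F) (hG : PolySeries G) :
    PolySeries fun n => F n * G n := by
  classical
  intro α
  simp only [MvPowerSeries.coeff_mul]
  exact sum_mem_polyFun fun p _ => mul_mem_polyFun (hF p.1) (hG p.2)

lemma pow {F : ℤ → MvPowerSeries σ A} (hF : PolySeries F) (k : ℕ) :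
    PolySeries fun n => F n ^ k := by
  induction k with
  | zero => simpa using one
  | succ k ih => simpa only [pow_succ] using ih.mul hF

lemma list_prod {κ : Type*} {F : κ → ℤ → MvPowerSeries σ A} (hF : ∀ k, PolySeries (F k))
    (l : List κ) : PolySeries fun n => (l.map fun k => F k n).prod := by
  induction l with
  | nil => simpa using one
  | cons k l ih => simpa using (hF k).mul ih

variable [Algebra ℚ A] [Algebra ℚ B]

lemma evalSeries (f : PowerSeries ℚ) {F : ℤ → MvPowerSeries σ A} (hF : PolySeries F) :
    PolySeries fun n => evalSeries f (F n) := by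
  intro α
  simp only [coeff_evalSeries]
  exact sum_mem_polyFun fun n _ =>
    map_mem_polyFun (DistribSMul.toAddMonoidHom A (PowerSeries.coeff n f)) (hF.pow n α)

lemma mapCoeff (L : A →ₗ[ℚ] B) {F : ℤ → MvPowerSeries σ A} (hF : PolySeries F) :
    PolySeries fun n => mapCoeff L (F n) := fun α => map_mem_polyFun L.toAddMonoidHom (hF α)

end PolySeries

/-- Each coefficient is built from the weights by finitely many sums, products and linear maps, all
of which preserve polynomial dependence. -/
lemma polySeries_weightedGenFun {σ : Type*} {w : ℤ → σ → ℚ ⊗[ℤ] R}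
    (hw : ∀ t, (fun n => w n t) ∈ polyFun (ℚ ⊗[ℤ] R)) :
    PolySeries fun n : ℤ => weightedGenFun (w n) := by
  have h : ∀ l, PolySeries fun n : ℤ => weightedPowerSum (w n) l := by
    intro l α
    by_cases hα : ∃ t, α = Finsupp.single t (l : ℕ)
    · obtain ⟨t, rfl⟩ := hα
      simp only [weightedPowerSum_single]
      exact hw t
    · simp only [weightedPowerSum_eq_zero _ _ (not_exists.1 hα)]
      exact const_mem_polyFun _
  have hf : ∀ l, PolySeries fun n : ℤ => weightedFactor (w n) l := by
    intro l
    have h₁ := ((h l).evalSeries (PowerSeries.log ℚ)).mapCoeff (T R l)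
    exact h₁.evalSeries (PowerSeries.exp ℚ)
  have hprod : ∀ d : ℕ, PolySeries fun n : ℤ =>
      ((List.range d).map fun k => weightedFactor (w n) k.succPNat).prod := fun d =>
    PolySeries.list_prod (A := GQ R) (fun k : ℕ => hf k.succPNat) (List.range d)
  intro α
  simp only [coeff_weightedGenFun]
  exact hprod _ α

/-! ### The group of coefficients and its independence of the basis -/

lemma powerSumElt_eq (b : Module.Basis ι ℤ R) (l : ℕ+) :
    powerSumElt b l = weightedPowerSum (fun x : ι × ℕ => (1 : ℚ) ⊗ₜ[ℤ] b x.1) l := by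
  classical
  ext α
  change ∑ᶠ U : ι, MvPowerSeries.coeff α (inVars U (powerSum l)) • ((1 : ℚ) ⊗ₜ[ℤ] b U) = _
  by_cases h : ∃ t, α = Finsupp.single t (l : ℕ)
  · obtain ⟨⟨U, i⟩, rfl⟩ := h
    rw [weightedPowerSum_single, finsum_eq_single _ U]
    · have : Finsupp.single (U, i) (l : ℕ) =
          (Finsupp.single i (l : ℕ)).embDomain (Function.Embedding.sectR U ℕ) := by
        rw [Finsupp.embDomain_single]
        rfl
      rw [this, inVars, MvPowerSeries.coeff_embDomain_rename]
      have h1 : MvPowerSeries.coeff (Finsupp.single i (l : ℕ)) (powerSum l) = 1 :=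
        if_pos ⟨i, rfl⟩
      rw [h1, one_smul]
    · intro V hV
      rw [inVars, MvPowerSeries.coeff_rename_eq_zero, zero_smul]
      rintro ⟨a, ha⟩
      have := congrArg (fun c => c (U, i)) ha
      simp only [Finsupp.single_eq_same] at this
      rw [Finsupp.mapDomain_of_notMem_range] at this
      · exact l.ne_zero this.symm
      · rintro ⟨j, hj⟩
        exact hV (congrArg Prod.fst hj)
  · rw [weightedPowerSum_eq_zero _ _ (not_exists.1 h), finsum_eq_zero_of_forall_eq_zero]
    intro U
    by_cases hα : α ∈ Set.range (Finsupp.mapDomain (M := ℕ) (Function.Embedding.sectR U ℕ))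
    · obtain ⟨a, rfl⟩ := hα
      rw [← Finsupp.embDomain_eq_mapDomain, inVars, MvPowerSeries.coeff_embDomain_rename]
      have h0 : MvPowerSeries.coeff a (powerSum l) = 0 := by
        refine if_neg ?_
        rintro ⟨i, rfl⟩
        exact h ⟨_, by rw [Finsupp.mapDomain_single]⟩
      rw [h0, zero_smul]
    · rw [inVars, MvPowerSeries.coeff_rename_eq_zero _ _ hα, zero_smul]

lemma genFun_eq (b : Module.Basis ι ℤ R) :
    genFun b = weightedGenFun fun x : ι × ℕ => (1 : ℚ) ⊗ₜ[ℤ] b x.1 := by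
  have h : ∀ l, genFactor b l =
      weightedFactor (fun x : ι × ℕ => (1 : ℚ) ⊗ₜ[ℤ] b x.1) l := fun l => by
    rw [genFactor, powerSumElt_eq, weightedFactor]
  unfold genFun weightedGenFun
  simp only [h]
  rfl

/-- The group generated by the coefficients of the generating function. -/
def coeffGroup (b : Module.Basis ι ℤ R) : AddSubgroup (GQ R) :=
  AddSubgroup.closure (Set.range fun α => MvPowerSeries.coeff α (genFun b))

lemma coeff_genFun_mem (b : Module.Basis ι ℤ R) (α : ι × ℕ →₀ ℕ) :
    MvPowerSeries.coeff α (genFun b) ∈ coeffGroup b :=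
  AddSubgroup.subset_closure ⟨α, rfl⟩

section CoeffGroup

variable (b : Module.Basis ι ℤ R)

lemma coeff_mem_coeffGroup_of_range {τ : Type*} [Finite τ] (U : τ → ι) (α : τ →₀ ℕ) :
    MvPowerSeries.coeff α (weightedGenFun fun t => (1 : ℚ) ⊗ₜ[ℤ] b (U t)) ∈ coeffGroup b := by
  obtain ⟨n, ⟨e⟩⟩ := Finite.exists_equiv_fin τ
  -- A basis element may be repeated in `U`; numbering `τ` by `e` gives each occurrence its own
  -- variable.
  let j : τ ↪ ι × ℕ := ⟨fun t => (U t, e t), fun s t h => by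
    simpa [Fin.val_inj] using congrArg Prod.snd h⟩
  have := coeff_weightedGenFun_comp (fun x : ι × ℕ => (1 : ℚ) ⊗ₜ[ℤ] b x.1) j α
  rw [← genFun_eq] at this
  exact this ▸ coeff_genFun_mem b _

lemma coeff_mem_coeffGroup_of_closure {σ : Type*} [Finite σ] {r : σ → R}
    (hr : ∀ s, r s ∈ AddSubmonoid.closure (Set.range b)) (β : σ →₀ ℕ) :
    MvPowerSeries.coeff β (weightedGenFun fun s => (1 : ℚ) ⊗ₜ[ℤ] r s) ∈ coeffGroup b := by
  classical
  cases nonempty_fintype σ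
  choose l hl hsum using fun s => AddSubmonoid.exists_list_of_mem_closure (hr s)
  -- One auxiliary variable for each summand of each `r s`; the first projection then identifies the
  -- variables belonging to the same `s`.
  choose U hU using fun x : Σ s, Fin (l s).length => hl x.1 _ (List.get_mem (l x.1) x.2)
  have e : (fun s => (1 : ℚ) ⊗ₜ[ℤ] r s) = fun s =>
      ∑ x : (Σ s, Fin (l s).length) with x.1 = s, (1 : ℚ) ⊗ₜ[ℤ] b (U x) := by
    ext s
    rw [Finset.sum_filter, Fintype.sum_sigma, Finset.sum_eq_single s]
    · simp only [if_true, hU]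
      rw [← TensorProduct.tmul_sum, ← hsum]
      congr 1
      conv_lhs => rw [← List.ofFn_get (l s), List.sum_ofFn]
    · intro s' _ hs'
      simp [hs']
    · simp
  rw [e, coeff_weightedGenFun_fiber_sum
    (fun x : (Σ s, Fin (l s).length) => (1 : ℚ) ⊗ₜ[ℤ] b (U x)) Sigma.fst]
  exact sum_mem fun α _ => coeff_mem_coeffGroup_of_range b U α

lemma exists_eq_sub_of_closure (r : R) : ∃ x ∈ AddSubmonoid.closure (Set.range b),
    ∃ y ∈ AddSubmonoid.closure (Set.range b), r = x - y := by
  have hr : r ∈ AddSubgroup.closure (Set.range b) := by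
    rw [← Submodule.span_int_eq_addSubgroupClosure, b.span_eq]
    trivial
  induction hr using AddSubgroup.closure_induction with
  | mem x hx => exact ⟨x, AddSubmonoid.subset_closure hx, 0, zero_mem _, by simp⟩
  | zero => exact ⟨0, zero_mem _, 0, zero_mem _, by simp⟩
  | add r s _ _ hr hs =>
    obtain ⟨x, hx, y, hy, rfl⟩ := hr
    obtain ⟨z, hz, t, ht, rfl⟩ := hs
    exact ⟨x + z, add_mem hx hz, y + t, add_mem hy ht, by abel⟩
  | neg r _ hr =>
    obtain ⟨x, hx, y, hy, rfl⟩ := hr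
    exact ⟨y, hy, x, hx, by abel⟩

lemma coeff_mem_coeffGroup_of_finite {σ : Type*} [Finite σ] (r : σ → R) (β : σ →₀ ℕ) :
    MvPowerSeries.coeff β (weightedGenFun fun s => (1 : ℚ) ⊗ₜ[ℤ] r s) ∈ coeffGroup b := by
  choose x hx y hy h using fun s => exists_eq_sub_of_closure b (r s)
  -- For `n ≥ 0` the weights are sums of basis elements; at `n = -1` they are the given `r s = x s -
  -- y s`.
  have hp := polySeries_weightedGenFun (w := fun n s => (1 : ℚ) ⊗ₜ[ℤ] (x s + n • y s))
    (fun s => map_mem_polyFun (TensorProduct.mk ℤ ℚ R 1).toAddMonoidHom (g := fun n => x s + n • y s)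
      (add_mem (const_mem_polyFun _) (by simpa only [pow_one] using pow_smul_mem_polyFun 1 (y s))))
    β
  have := apply_neg_one_mem_of_polyFun hp (coeffGroup b) fun n =>
    coeff_mem_coeffGroup_of_closure b
      (fun s => add_mem (hx s) (by simpa only [natCast_zsmul] using nsmul_mem (hy s) n)) β
  simpa only [h, neg_one_zsmul, ← sub_eq_add_neg] using this

/-- The coefficient at `β` is unchanged when the variables outside the finite support of `β` are set
to zero. -/
lemma coeff_mem_coeffGroup {σ : Type*} (r : σ → R) (β : σ →₀ ℕ) :
    MvPowerSeries.coeff β (weightedGenFun fun s => (1 : ℚ) ⊗ₜ[ℤ] r s) ∈ coeffGroup b := by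
  obtain ⟨β', hβ⟩ : ∃ β' : β.support →₀ ℕ,
      β'.embDomain (Function.Embedding.subtype _) = β := by
    rw [← Set.mem_range, Finsupp.mem_range_embDomain_iff]
    intro x hx
    simpa using hx
  have e := coeff_weightedGenFun_comp (fun s => (1 : ℚ) ⊗ₜ[ℤ] r s)
    (Function.Embedding.subtype (· ∈ β.support)) β'
  rw [hβ] at e
  rw [← e]
  exact coeff_mem_coeffGroup_of_finite b (fun s : β.support => r s) β'

end CoeffGroup

lemma coeffGroup_le {ι' : Type*} (b : Module.Basis ι ℤ R) (b' : Module.Basis ι' ℤ R) :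
    coeffGroup b' ≤ coeffGroup b := by
  rw [coeffGroup, AddSubgroup.closure_le]
  rintro _ ⟨α, rfl⟩
  rw [genFun_eq]
  exact coeff_mem_coeffGroup b (fun x : ι' × ℕ => b' x.1) α

lemma coeffGroup_eq {ι' : Type*} (b : Module.Basis ι ℤ R) (b' : Module.Basis ι' ℤ R) :
    coeffGroup b = coeffGroup b' :=
  le_antisymm (coeffGroup_le b' b) (coeffGroup_le b b')

lemma coeff_genFun_embDomain (b : Module.Basis ι ℤ R) (e : ι × ℕ ≃ ι × ℕ)
    (he : ∀ x, (e x).1 = x.1) (α : ι × ℕ →₀ ℕ) :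
    MvPowerSeries.coeff (α.embDomain e.toEmbedding) (genFun b) =
      MvPowerSeries.coeff α (genFun b) := by
  rw [genFun_eq, ← coeff_weightedGenFun_comp]
  congr 2
  ext x
  simp [he]

/-! ### Leading monomials of Jacobi-Trudi determinants -/

lemma coeff_completeSymm (n : ℕ) (α : ℕ →₀ ℕ) :
    MvPowerSeries.coeff α (completeSymm n) = if α.degree = n then 1 else 0 := rfl

lemma completeSymm_zero : completeSymm 0 = 1 := by
  classical
  ext α
  rw [coeff_completeSymm, MvPowerSeries.coeff_one]
  exact if_congr (Finsupp.degree_eq_zero_iff α) rfl rfl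

/-- The sequence `k, a_0, a_1, …`. -/
def consSeq (k : ℕ) (a : ℕ →₀ ℕ) : ℕ →₀ ℕ :=
  Finsupp.single 0 k + a.mapDomain Nat.succ

/-- The sequence `a_1, a_2, …`. -/
def tailSeq (a : ℕ →₀ ℕ) : ℕ →₀ ℕ := a.comapDomain Nat.succ Nat.succ_injective.injOn

@[simp] lemma consSeq_zero (k : ℕ) (a : ℕ →₀ ℕ) : consSeq k a 0 = k := by
  rw [consSeq, Finsupp.add_apply, Finsupp.mapDomain_of_notMem_range] <;> simp

@[simp] lemma consSeq_succ (k : ℕ) (a : ℕ →₀ ℕ) (i : ℕ) : consSeq k a (i + 1) = a i := by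
  rw [consSeq, Finsupp.add_apply, Finsupp.mapDomain_apply Nat.succ_injective]
  simp

@[simp] lemma tailSeq_apply (a : ℕ →₀ ℕ) (i : ℕ) : tailSeq a i = a (i + 1) := rfl

lemma consSeq_tailSeq (a : ℕ →₀ ℕ) : consSeq (a 0) (tailSeq a) = a := by
  ext i
  cases i <;> simp

lemma tailSeq_consSeq (k : ℕ) (a : ℕ →₀ ℕ) : tailSeq (consSeq k a) = a := by
  ext i
  simp

lemma consSeq_add (k l : ℕ) (a c : ℕ →₀ ℕ) :
    consSeq k a + consSeq l c = consSeq (k + l) (a + c) := by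
  ext i
  cases i <;> simp

lemma tailSeq_add (a c : ℕ →₀ ℕ) : tailSeq (a + c) = tailSeq a + tailSeq c := by
  ext i
  simp

lemma degree_consSeq (k : ℕ) (a : ℕ →₀ ℕ) : (consSeq k a).degree = k + a.degree := by
  rw [consSeq, map_add, Finsupp.degree_single, Finsupp.degree_mapDomain]

/-- The coefficient of `x_0 ^ k`, as a power series in the other variables, which are renumbered. -/
def headCoeff (F : MvPowerSeries ℕ ℤ) (k : ℕ) : MvPowerSeries ℕ ℤ :=
  fun a => MvPowerSeries.coeff (consSeq k a) F

/-- The expansion of a power series in powers of the variable `x_0`, as a function. -/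
def expandHeadFun (F : MvPowerSeries ℕ ℤ) : PowerSeries (MvPowerSeries ℕ ℤ) :=
  PowerSeries.mk (headCoeff F)

lemma coeff_coeff_expandHeadFun (F : MvPowerSeries ℕ ℤ) (k : ℕ) (a : ℕ →₀ ℕ) :
    MvPowerSeries.coeff a (PowerSeries.coeff k (expandHeadFun F)) =
      MvPowerSeries.coeff (consSeq k a) F := by
  rw [expandHeadFun, PowerSeries.coeff_mk]
  rfl

lemma expandHeadFun_one : expandHeadFun 1 = 1 := by
  classical
  ext k a
  have h : consSeq k a = 0 ↔ k = 0 ∧ a = 0 := by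
    rw [← Finsupp.degree_eq_zero_iff, degree_consSeq, Nat.add_eq_zero_iff,
      Finsupp.degree_eq_zero_iff]
  rw [coeff_coeff_expandHeadFun, PowerSeries.coeff_one, MvPowerSeries.coeff_one]
  split_ifs <;> simp_all [MvPowerSeries.coeff_one]

lemma expandHeadFun_mul (F G : MvPowerSeries ℕ ℤ) :
    expandHeadFun (F * G) = expandHeadFun F * expandHeadFun G := by
  classical
  ext k a
  rw [coeff_coeff_expandHeadFun, PowerSeries.coeff_mul, map_sum, MvPowerSeries.coeff_mul]
  simp only [MvPowerSeries.coeff_mul, coeff_coeff_expandHeadFun]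
  rw [← Finset.sum_product']
  refine Finset.sum_bij' (fun p _ => ((p.1 0, p.2 0), (tailSeq p.1, tailSeq p.2)))
    (fun p _ => (consSeq p.1.1 p.2.1, consSeq p.1.2 p.2.2)) ?_ ?_ ?_ ?_ ?_
  · rintro ⟨p, q⟩ h
    rw [Finset.HasAntidiagonal.mem_antidiagonal] at h
    simp only [Finset.mem_product, Finset.HasAntidiagonal.mem_antidiagonal]
    simp only at h
    rw [← tailSeq_add, h, tailSeq_consSeq, ← Finsupp.add_apply, h, consSeq_zero]
    exact ⟨rfl, rfl⟩
  · rintro ⟨⟨k, l⟩, a, c⟩ h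
    simp only [Finset.mem_product, Finset.HasAntidiagonal.mem_antidiagonal] at h ⊢
    rw [consSeq_add, h.1, h.2]
  · rintro ⟨p, q⟩ h
    simp only [consSeq_tailSeq]
  · rintro ⟨⟨k, l⟩, a, c⟩ h
    simp only [tailSeq_consSeq, consSeq_zero]
  · rintro ⟨p, q⟩ h
    simp only [consSeq_tailSeq]

/-- The expansion of a power series in powers of the variable `x_0`. -/
def expandHead : MvPowerSeries ℕ ℤ →+* PowerSeries (MvPowerSeries ℕ ℤ) where
  toFun := expandHeadFun
  map_zero' := by
    ext k a
    rw [coeff_coeff_expandHeadFun]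
    simp
  map_add' F G := by
    ext k a
    rw [map_add, map_add]
    simp only [coeff_coeff_expandHeadFun, map_add]
  map_one' := expandHeadFun_one
  map_mul' := expandHeadFun_mul

lemma coeff_coeff_expandHead (F : MvPowerSeries ℕ ℤ) (k : ℕ) (a : ℕ →₀ ℕ) :
    MvPowerSeries.coeff a (PowerSeries.coeff k (expandHead F)) =
      MvPowerSeries.coeff (consSeq k a) F :=
  coeff_coeff_expandHeadFun F k a

lemma coeff_expandHead_completeSymm (n k : ℕ) :
    PowerSeries.coeff k (expandHead (completeSymm n)) =
      if k ≤ n then completeSymm (n - k) else 0 := by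
  ext a
  rw [coeff_coeff_expandHead, coeff_completeSymm, degree_consSeq]
  split_ifs with h₁ h₂ h₂
  · rw [coeff_completeSymm, if_pos (by omega)]
  · omega
  · rw [coeff_completeSymm, if_neg (by omega)]
  · simp

/-- A monomial of degree `n + 1` either avoids `x_0` or is `x_0` times a monomial of degree `n`. -/
lemma expandHead_completeSymm_succ (n : ℕ) :
    expandHead (completeSymm (n + 1)) =
      PowerSeries.C (completeSymm (n + 1)) + PowerSeries.X * expandHead (completeSymm n) := by
  ext1 k
  rw [map_add, coeff_expandHead_completeSymm]
  cases k with
  | zero => simp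
  | succ k =>
    rw [PowerSeries.coeff_succ_X_mul, coeff_expandHead_completeSymm, PowerSeries.coeff_C]
    simp

/-- The entry `h_{m_i - i + j}` of the Jacobi-Trudi matrix. -/
def jacobiTrudiEntry (m : ℕ → ℕ) (i j : ℕ) : MvPowerSeries ℕ ℤ :=
  if i ≤ m i + j then completeSymm (m i + j - i) else 0

/-- The Jacobi-Trudi determinant of a sequence. -/
def jacobiTrudi (n : ℕ) (m : ℕ → ℕ) : MvPowerSeries ℕ ℤ :=
  Matrix.det (Matrix.of fun i j : Fin n => jacobiTrudiEntry m i j)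

lemma schur_eq (μ : YoungDiagram) : schur μ = jacobiTrudi (μ.colLen 0) μ.rowLen := rfl

lemma expandHead_jacobiTrudiEntry_succ (m : ℕ → ℕ) (i j : ℕ) :
    expandHead (jacobiTrudiEntry m i (j + 1)) = PowerSeries.C (jacobiTrudiEntry m i (j + 1)) +
      PowerSeries.X * expandHead (jacobiTrudiEntry m i j) := by
  unfold jacobiTrudiEntry
  by_cases h : i ≤ m i + j
  · rw [if_pos h, if_pos (by omega), show m i + (j + 1) - i = m i + j - i + 1 by omega,
      expandHead_completeSymm_succ]
  · rw [if_neg h]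
    split_ifs with h'
    · rw [show m i + (j + 1) - i = 0 by omega, completeSymm_zero]
      simp
    · simp

/-- Subtracting `x_0` times the preceding column from each column removes `x_0` from every column
but the first, along which the determinant is then expanded. -/
lemma expandHead_jacobiTrudi (n : ℕ) (m : ℕ → ℕ) (k : ℕ) :
    PowerSeries.coeff k (expandHead (jacobiTrudi (n + 1) m)) =
      ∑ i : Fin (n + 1), (-1) ^ (i : ℕ) *
        PowerSeries.coeff k (expandHead (jacobiTrudiEntry m i 0)) *
        Matrix.det (Matrix.of fun i' j : Fin n => jacobiTrudiEntry m (i.succAbove i') (j + 1)) := by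
  let B : Matrix (Fin (n + 1)) (Fin (n + 1)) (PowerSeries (MvPowerSeries ℕ ℤ)) :=
    Matrix.of fun i j => Fin.cases (expandHead (jacobiTrudiEntry m i 0))
      (fun j : Fin n => PowerSeries.C (jacobiTrudiEntry m i (j + 1))) j
  have hdet : expandHead (jacobiTrudi (n + 1) m) = B.det := by
    rw [jacobiTrudi, RingHom.map_det]
    refine Matrix.det_eq_of_forall_col_eq_smul_add_pred (fun _ => PowerSeries.X) ?_ ?_
    · intro i
      rfl
    · intro i j
      exact expandHead_jacobiTrudiEntry_succ m i j
  rw [hdet, Matrix.det_succ_column_zero, map_sum]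
  refine Finset.sum_congr rfl fun i _ => ?_
  have hminor : (B.submatrix i.succAbove Fin.succ).det = PowerSeries.C
      (Matrix.det (Matrix.of fun i' j : Fin n =>
        jacobiTrudiEntry m (i.succAbove i') (j + 1))) := by
    rw [RingHom.map_det]
    rfl
  rw [hminor, PowerSeries.coeff_mul_C]
  congr 1
  rw [show ((-1 : PowerSeries (MvPowerSeries ℕ ℤ)) ^ (i : ℕ)) = PowerSeries.C ((-1) ^ (i : ℕ)) by
    simp, PowerSeries.coeff_C_mul]
  rfl

lemma coeff_expandHead_jacobiTrudiEntry (m : ℕ → ℕ) (i k : ℕ) (h : m i < k + i) :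
    PowerSeries.coeff k (expandHead (jacobiTrudiEntry m i 0)) = 0 := by
  unfold jacobiTrudiEntry
  split_ifs with h'
  · rw [coeff_expandHead_completeSymm, if_neg (by omega)]
  · simp

lemma coeff_jacobiTrudi_eq_zero {n : ℕ} {m : ℕ → ℕ} (hm : Antitone m) {k : ℕ} (hk : m 0 < k)
    (a : ℕ →₀ ℕ) : MvPowerSeries.coeff (consSeq k a) (jacobiTrudi (n + 1) m) = 0 := by
  rw [← coeff_coeff_expandHead, expandHead_jacobiTrudi, Finset.sum_eq_zero, map_zero]
  intro i _
  have := hm (Nat.zero_le (i : ℕ))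
  rw [coeff_expandHead_jacobiTrudiEntry m i k (by omega), mul_zero, zero_mul]

/-- In the first column, row `i` has degree at most `m i - i` in `x_0`, which is below `m 0` for `i
> 0`. Only row `0` contributes, and its minor is the determinant of the shifted sequence because the
shifts of row and column cancel. -/
lemma coeff_jacobiTrudi_head {n : ℕ} {m : ℕ → ℕ} (hm : Antitone m) (a : ℕ →₀ ℕ) :
    MvPowerSeries.coeff (consSeq (m 0) a) (jacobiTrudi (n + 1) m) =
      MvPowerSeries.coeff a (jacobiTrudi n fun i => m (i + 1)) := by
  rw [← coeff_coeff_expandHead, expandHead_jacobiTrudi, Finset.sum_eq_single 0]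
  · have h0 : PowerSeries.coeff (m 0) (expandHead (jacobiTrudiEntry m 0 0)) = 1 := by
      rw [jacobiTrudiEntry, if_pos (Nat.zero_le _), coeff_expandHead_completeSymm,
        if_pos (by omega)]
      simp [completeSymm_zero]
    have hd : (Matrix.of fun i' j : Fin n =>
        jacobiTrudiEntry m ((0 : Fin (n + 1)).succAbove i') (j + 1)) =
        Matrix.of fun i j : Fin n => jacobiTrudiEntry (fun i => m (i + 1)) i j := by
      ext1 i j
      rw [Matrix.of_apply, Matrix.of_apply, Fin.succAbove_zero, Fin.val_succ]
      unfold jacobiTrudiEntry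
      refine if_congr (by beta_reduce; omega) ?_ rfl
      rw [← add_assoc, Nat.add_sub_add_right]
    rw [hd]
    simp only [Fin.val_zero, pow_zero, h0, one_mul]
    rfl
  · intro i _ hi
    have hi' : 0 < (i : ℕ) := Nat.pos_of_ne_zero fun h => hi (Fin.ext h)
    have := hm (Nat.zero_le (i : ℕ))
    rw [coeff_expandHead_jacobiTrudiEntry m i _ (by omega), mul_zero, zero_mul]
  · simp

/-- The leading monomial of a Jacobi-Trudi determinant in the lexicographic order. -/
lemma coeff_jacobiTrudi (n : ℕ) {m : ℕ → ℕ} (hm : Antitone m) (hn : ∀ i ≥ n, m i = 0)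
    (α : ℕ →₀ ℕ) :
    (MvPowerSeries.coeff α (jacobiTrudi n m) ≠ 0 → toLex ⇑α ≤ toLex m) ∧
      (⇑α = m → MvPowerSeries.coeff α (jacobiTrudi n m) = 1) := by
  classical
  induction n generalizing m α with
  | zero =>
    have hm0 : m = 0 := funext fun i => hn i (Nat.zero_le i)
    rw [jacobiTrudi, Matrix.det_fin_zero, MvPowerSeries.coeff_one, hm0]
    constructor
    · intro h
      rw [(ite_ne_right_iff.1 h).1]
      rfl
    · intro h
      exact if_pos (DFunLike.coe_injective h)
  | succ n ih =>
    have ih' := ih (m := fun i => m (i + 1)) (fun i j h => hm (Nat.succ_le_succ h))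
      (fun i hi => hn _ (Nat.succ_le_succ hi)) (tailSeq α)
    rcases lt_trichotomy (α 0) (m 0) with h | h | h
    · exact ⟨fun _ => le_of_lt ⟨0, by simp, h⟩, fun e => absurd (congrFun e 0) h.ne⟩
    · have e : MvPowerSeries.coeff α (jacobiTrudi (n + 1) m) =
          MvPowerSeries.coeff (tailSeq α) (jacobiTrudi n fun i => m (i + 1)) := by
        rw [← coeff_jacobiTrudi_head hm, ← h, consSeq_tailSeq]
      rw [e]
      constructor
      · intro hne
        rcases (ih'.1 hne).eq_or_lt with h' | ⟨i, hi, hlt⟩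
        · refine le_of_eq (congrArg toLex (funext fun i => ?_))
          cases i with
          | zero => exact h
          | succ i => exact congrFun (toLex.injective h') i
        · refine le_of_lt ⟨i + 1, fun j hj => ?_, hlt⟩
          cases j with
          | zero => exact h
          | succ j => exact hi j (Nat.lt_of_succ_lt_succ hj)
      · intro h'
        exact ih'.2 (funext fun i => congrFun h' (i + 1))
    · refine ⟨fun hne => absurd ?_ hne, fun e => absurd (congrFun e 0) h.ne'⟩
      rw [← consSeq_tailSeq α]
      exact coeff_jacobiTrudi_eq_zero hm h _

/-- All monomials of a power series have degree `n`. -/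
def IsHomogeneousOfDegree (F : MvPowerSeries ℕ ℤ) (n : ℕ) : Prop :=
  ∀ α, MvPowerSeries.coeff α F ≠ 0 → α.degree = n

lemma IsHomogeneousOfDegree.prod {κ : Type*} (s : Finset κ) {F : κ → MvPowerSeries ℕ ℤ}
    {n : κ → ℕ} (h : ∀ i ∈ s, IsHomogeneousOfDegree (F i) (n i)) :
    IsHomogeneousOfDegree (∏ i ∈ s, F i) (∑ i ∈ s, n i) := by
  classical
  induction s using Finset.induction_on with
  | empty =>
    intro α hα
    rw [Finset.prod_empty, MvPowerSeries.coeff_one] at hα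
    rw [(ite_ne_right_iff.1 hα).1]
    simp
  | insert i s hi ih =>
    intro α hα
    rw [Finset.prod_insert hi, MvPowerSeries.coeff_mul] at hα
    obtain ⟨⟨p, q⟩, hp, hne⟩ := Finset.exists_ne_zero_of_sum_ne_zero hα
    rw [Finset.HasAntidiagonal.mem_antidiagonal] at hp
    rw [← hp, map_add, Finset.sum_insert hi,
      h i (Finset.mem_insert_self i s) p (left_ne_zero_of_mul hne),
      ih (fun j hj => h j (Finset.mem_insert_of_mem hj)) q (right_ne_zero_of_mul hne)]

/-- In each nonzero term of the Leibniz formula the row and column indices are summed over the same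
set, so their contributions to the degree cancel. -/
lemma degree_eq_of_coeff_jacobiTrudi_ne_zero (n : ℕ) (m : ℕ → ℕ) :
    IsHomogeneousOfDegree (jacobiTrudi n m) (∑ i : Fin n, m i) := by
  intro α hα
  rw [jacobiTrudi, Matrix.det_apply, map_sum] at hα
  obtain ⟨w, -, hw⟩ := Finset.exists_ne_zero_of_sum_ne_zero hα
  rw [Units.smul_def, map_zsmul] at hw
  have hw' := right_ne_zero_of_smul hw
  by_cases hle : ∀ i : Fin n, (w i : ℕ) ≤ m (w i) + i
  · have hhom := IsHomogeneousOfDegree.prod Finset.univ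
      (F := fun i => jacobiTrudiEntry m (w i) i) (n := fun i => m (w i) + (i : ℕ) - (w i : ℕ))
      (fun i _ β hβ => by
        rw [jacobiTrudiEntry, if_pos (hle i), coeff_completeSymm] at hβ
        exact (ite_ne_right_iff.1 hβ).1) α hw'
    have h₁ : ∑ i, (m (w i) + (i : ℕ) - (w i : ℕ)) + ∑ i, (w i : ℕ) = ∑ i, (m (w i) + (i : ℕ)) := by
      rw [← Finset.sum_add_distrib]
      exact Finset.sum_congr rfl fun i _ => Nat.sub_add_cancel (hle i)
    rw [Finset.sum_add_distrib, Equiv.sum_comp w fun i => (i : ℕ),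
      Equiv.sum_comp w fun i => m (i : ℕ)] at h₁
    omega
  · obtain ⟨i, hi⟩ := not_forall.1 hle
    refine absurd ?_ hw'
    rw [Finset.prod_eq_zero (Finset.mem_univ i), map_zero]
    exact if_neg hi

/-! ### Schur functions: leading monomial, degree and symmetry -/

lemma rowLen_eq_zero (μ : YoungDiagram) {i : ℕ} (hi : μ.colLen 0 ≤ i) : μ.rowLen i = 0 := by
  by_contra h
  have := YoungDiagram.mem_iff_lt_rowLen.2 (Nat.pos_of_ne_zero h)
  rw [YoungDiagram.mem_iff_lt_colLen] at this
  omega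

lemma sum_rowLen (μ : YoungDiagram) : ∑ i : Fin (μ.colLen 0), μ.rowLen i = μ.card := by
  rw [Fin.sum_univ_eq_sum_range fun i => μ.rowLen i, YoungDiagram.card,
    Finset.card_eq_sum_card_fiberwise (f := Prod.fst) (t := Finset.range (μ.colLen 0))]
  · exact Finset.sum_congr rfl fun i _ => μ.rowLen_eq_card
  · rintro ⟨i, j⟩ h
    have : (i, 0) ∈ μ := μ.up_left_mem le_rfl (Nat.zero_le j) h
    simpa using YoungDiagram.mem_iff_lt_colLen.1 this

/-- The exponent `(μ_0, μ_1, …)` of the leading monomial of `s_μ`. -/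
def rowSeq (μ : YoungDiagram) : ℕ →₀ ℕ :=
  Finsupp.onFinset (Finset.range (μ.colLen 0)) μ.rowLen fun i hi => by
    by_contra h
    exact hi (rowLen_eq_zero μ (by simpa using h))

@[simp] lemma rowSeq_apply (μ : YoungDiagram) (i : ℕ) : rowSeq μ i = μ.rowLen i := rfl

lemma toLex_le_of_coeff_schur_ne_zero {μ : YoungDiagram} {α : ℕ →₀ ℕ}
    (h : MvPowerSeries.coeff α (schur μ) ≠ 0) : toLex ⇑α ≤ toLex μ.rowLen :=
  (coeff_jacobiTrudi _ (fun i j => μ.rowLen_anti i j) (fun _ => rowLen_eq_zero μ) α).1 h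

lemma coeff_schur_rowSeq (μ : YoungDiagram) :
    MvPowerSeries.coeff (rowSeq μ) (schur μ) = 1 :=
  (coeff_jacobiTrudi _ (fun i j => μ.rowLen_anti i j) (fun _ => rowLen_eq_zero μ) _).2 rfl

lemma degree_eq_of_coeff_schur_ne_zero {μ : YoungDiagram} {α : ℕ →₀ ℕ}
    (h : MvPowerSeries.coeff α (schur μ) ≠ 0) : α.degree = μ.card := by
  rw [degree_eq_of_coeff_jacobiTrudi_ne_zero _ _ α h, sum_rowLen]

lemma degree_rowSeq (μ : YoungDiagram) : (rowSeq μ).degree = μ.card :=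
  degree_eq_of_coeff_schur_ne_zero (by rw [coeff_schur_rowSeq]; exact one_ne_zero)

lemma schur_eq_one {μ : YoungDiagram} (h : μ.card = 0) : schur μ = 1 := by
  have h0 : μ.colLen 0 = 0 := by
    by_contra hne
    have : (0, 0) ∈ μ := YoungDiagram.mem_iff_lt_colLen.2 (Nat.pos_of_ne_zero hne)
    exact (Finset.card_pos.2 ⟨_, this⟩).ne' h
  rw [schur_eq, h0, jacobiTrudi, Matrix.det_fin_zero]

/-- Coefficients of `h_n` depend only on the degree, so each `h_n` is fixed by the ring homomorphism
attached to `e`, and hence so is a determinant in them. -/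
lemma coeff_embDomain_schur (μ : YoungDiagram) (e : ℕ ↪ ℕ) (α : ℕ →₀ ℕ) :
    MvPowerSeries.coeff (α.embDomain e) (schur μ) = MvPowerSeries.coeff α (schur μ) := by
  let K := MonomialTransfer.ofEmbedding e
  have hc : ∀ F : MvPowerSeries ℕ ℤ, ∀ β, MvPowerSeries.coeff β (K.hom ℤ F) =
      MvPowerSeries.coeff (β.embDomain e) F := fun F β => Finset.sum_singleton _ _
  have hh : ∀ n, K.hom ℤ (completeSymm n) = completeSymm n := by
    intro n
    ext β
    rw [hc, coeff_completeSymm, coeff_completeSymm, Finsupp.embDomain_eq_mapDomain,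
      Finsupp.degree_mapDomain]
  have hs : K.hom ℤ (schur μ) = schur μ := by
    rw [schur, RingHom.map_det]
    congr 1
    ext1 i j
    simp only [RingHom.mapMatrix_apply, Matrix.map_apply, Matrix.of_apply]
    split_ifs
    · exact hh _
    · exact map_zero _
  rw [← hc, hs]

lemma exists_youngDiagram_of_antitone {m : ℕ → ℕ} (hm : Antitone m) {n : ℕ}
    (hn : ∀ i ≥ n, m i = 0) : ∃ μ : YoungDiagram, μ.rowLen = m := by
  let μ : YoungDiagram :=
    { cells := (Finset.range n ×ˢ Finset.range (m 0)).filter fun c => c.2 < m c.1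
      isLowerSet := by
        rintro ⟨i, j⟩ ⟨i', j'⟩ ⟨hi, hj⟩ h
        simp only [Finset.coe_filter, Finset.mem_product, Finset.mem_range,
          Set.mem_ofPred_eq] at h ⊢
        simp only at hi hj
        have := hm hi
        have := hm (Nat.zero_le i')
        omega }
  refine ⟨μ, funext fun i => ?_⟩
  have h : ∀ j, j < μ.rowLen i ↔ j < m i := by
    intro j
    rw [← YoungDiagram.mem_iff_lt_rowLen]
    change (i, j) ∈ Finset.filter _ _ ↔ _
    simp only [Finset.mem_filter, Finset.mem_product, Finset.mem_range]
    have := hm (Nat.zero_le i)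
    have := hn i
    by_cases i < n <;> omega
  have h₁ := h (m i)
  have h₂ := h (μ.rowLen i)
  omega

lemma exists_perm_eq_rowSeq (α : ℕ →₀ ℕ) :
    ∃ (e : Equiv.Perm ℕ) (μ : YoungDiagram), (rowSeq μ).embDomain e.toEmbedding = α := by
  obtain ⟨n, hn⟩ : ∃ n, ∀ i ≥ n, α i = 0 := by
    obtain ⟨n, hn⟩ := α.support.exists_nat_subset_range
    refine ⟨n, fun i hi => ?_⟩
    by_contra h
    have := hn (Finsupp.mem_support_iff.2 h)
    rw [Finset.mem_range] at this
    omega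
  -- The order dual makes the sort decreasing; the sorting permutation is extended by the identity
  -- beyond `n`.
  let f : Fin n → ℕᵒᵈ := fun i => OrderDual.toDual (α i)
  let e : Equiv.Perm ℕ := (Tuple.sort f).viaFintypeEmbedding Fin.valEmbedding
  have he : ∀ i : Fin n, e i = (Tuple.sort f i : ℕ) := fun i =>
    Equiv.Perm.viaFintypeEmbedding_apply_image (Tuple.sort f) Fin.valEmbedding i
  have he' : ∀ i ≥ n, e i = i := fun i hi =>
    Equiv.Perm.viaFintypeEmbedding_apply_notMem_range _ _ (by
      rintro ⟨j, rfl⟩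
      exact absurd j.2 (not_lt.2 hi))
  have h0 : ∀ i ≥ n, α (e i) = 0 := fun i hi => by rw [he' i hi, hn i hi]
  have hanti : Antitone fun i => α (e i) := by
    intro i j hij
    by_cases hj : j < n
    · have := Tuple.monotone_sort f (show (⟨i, hij.trans_lt hj⟩ : Fin n) ≤ ⟨j, hj⟩ from hij)
      have e₁ := he ⟨i, hij.trans_lt hj⟩
      have e₂ := he ⟨j, hj⟩
      simp only at e₁ e₂ ⊢
      rw [e₁, e₂]
      exact this
    · simp only [h0 j (not_lt.1 hj), Nat.zero_le]
  obtain ⟨μ, hμ⟩ := exists_youngDiagram_of_antitone hanti h0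
  refine ⟨e, μ, ?_⟩
  ext i
  obtain ⟨j, rfl⟩ := e.surjective i
  have := Finsupp.embDomain_apply_self e.toEmbedding (rowSeq μ) j
  rw [rowSeq_apply, hμ] at this
  exact this

/-! ### Unitriangular systems over the integers -/

section Triangular

variable {Λ A : Type*} [AddCommGroup A] {M : Λ → Λ → ℤ} {r : Λ → Λ → Prop}

/-- A matrix over `ℤ` which is unitriangular for a partial order with finite upper sets. -/
structure IsUnitriangular (M : Λ → Λ → ℤ) (r : Λ → Λ → Prop) : Prop where
  diag : ∀ i, M i i = 1
  rel : ∀ {i j}, M i j ≠ 0 → r i j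
  trans : ∀ {i j k}, r i j → r j k → r i k
  antisymm : ∀ {i j}, r i j → r j i → i = j
  finite : ∀ i, {j | r i j}.Finite

namespace IsUnitriangular

lemma finite_above (h : IsUnitriangular M r) (i : Λ) : {j | r i j ∧ j ≠ i}.Finite :=
  (h.finite i).subset fun _ hj => hj.1

/-- Going strictly up shrinks the finite upper set, so its cardinality is a decreasing measure. -/
lemma wellFounded (h : IsUnitriangular M r) : WellFounded fun j i => r i j ∧ j ≠ i := by
  refine Subrelation.wf (r := InvImage (· < ·) fun i => {j | r i j}.ncard) ?_
    (InvImage.wf _ wellFounded_lt)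
  rintro j i ⟨hij, hne⟩
  refine Set.ncard_lt_ncard ⟨fun k hk => h.trans hij hk, fun hsub => hne ?_⟩ (h.finite i)
  have hi : r i i := h.rel (by rw [h.diag]; exact one_ne_zero)
  exact h.antisymm (hsub hi) hij

lemma finsum_eq (h : IsUnitriangular M r) (Z : Λ → A) (i : Λ) :
    ∑ᶠ j, M i j • Z j = Z i + ∑ j ∈ (h.finite_above i).toFinset, M i j • Z j := by
  classical
  rw [finsum_eq_sum_of_support_subset (s := insert i (h.finite_above i).toFinset),
    Finset.sum_insert (by simp), h.diag, one_smul]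
  intro j hj
  by_cases hji : j = i
  · simp [hji]
  · simp only [Finset.coe_insert, Set.Finite.coe_toFinset]
    exact Or.inr ⟨h.rel (left_ne_zero_of_smul hj), hji⟩

lemma exists_solution (h : IsUnitriangular M r) (F : Λ → A) :
    ∃ Z : Λ → A, ∀ i, ∑ᶠ j, M i j • Z j = F i := by
  let Z : Λ → A := h.wellFounded.fix fun i Z =>
    F i - ∑ j ∈ (h.finite_above i).toFinset.attach,
      M i j • Z j ((h.finite_above i).mem_toFinset.1 j.2)
  refine ⟨Z, fun i => ?_⟩
  have hZ : Z i = F i - ∑ j ∈ (h.finite_above i).toFinset.attach, M i j • Z j :=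
    h.wellFounded.fix_eq _ i
  rw [Finset.sum_attach _ fun j => M i j • Z j] at hZ
  rw [h.finsum_eq, hZ, sub_add_cancel]

lemma solution_mem (h : IsUnitriangular M r) {Z : Λ → A} (N : AddSubgroup A)
    (hZ : ∀ i, ∑ᶠ j, M i j • Z j ∈ N) (i : Λ) : Z i ∈ N := by
  induction i using h.wellFounded.induction with
  | _ i ih =>
    have hi := hZ i
    rw [h.finsum_eq] at hi
    refine (AddSubgroup.add_mem_cancel_right N (sum_mem fun j hj => zsmul_mem (ih j ?_) _)).1 hi
    exact (h.finite_above i).mem_toFinset.1 hj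

lemma solution_unique (h : IsUnitriangular M r) {Z Z' : Λ → A}
    (hZ : ∀ i, ∑ᶠ j, M i j • Z j = ∑ᶠ j, M i j • Z' j) : Z = Z' := by
  have hfin : ∀ (i : Λ) (Z : Λ → A), (Function.support fun j => M i j • Z j).Finite :=
    fun i Z => (h.finite i).subset fun j hj => h.rel (left_ne_zero_of_smul hj)
  -- The difference solves the homogeneous system, so it lies in the trivial subgroup.
  have := h.solution_mem (Z := Z - Z') ⊥ fun i => by
    simp only [Pi.sub_apply, smul_sub]
    rw [finsum_sub_distrib (hfin i Z) (hfin i Z'), hZ, sub_self]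
    exact zero_mem _
  funext i
  exact sub_eq_zero.1 (AddSubgroup.mem_bot.1 (this i))

end IsUnitriangular

end Triangular

/-! ### Products of Schur functions indexed by multipartitions -/

/-- The exponents of the variables `𝐱_U` in a monomial. -/
def slice (α : ι × ℕ →₀ ℕ) (U : ι) : ℕ →₀ ℕ :=
  α.comapDomain (Prod.mk U) (Prod.mk_right_injective U).injOn

@[simp] lemma slice_apply (α : ι × ℕ →₀ ℕ) (U : ι) (i : ℕ) : slice α U i = α (U, i) := rfl

lemma slice_eq_zero {α : ι × ℕ →₀ ℕ} {U : ι} (h : ∀ x ∈ α.support, x.1 ≠ U) :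
    slice α U = 0 := by
  ext i
  by_contra hne
  exact h (U, i) (Finsupp.mem_support_iff.2 hne) rfl

lemma embDomain_slice (α : ι × ℕ →₀ ℕ) (U : ι) [DecidablePred fun x : ι × ℕ => x.1 = U] :
    (slice α U).embDomain (Function.Embedding.sectR U ℕ) = α.filter fun x => x.1 = U := by
  ext ⟨V, i⟩
  by_cases h : V = U
  · subst h
    rw [Finsupp.filter_apply_pos (fun x : ι × ℕ => x.1 = V) _ rfl]
    exact Finsupp.embDomain_apply_self (Function.Embedding.sectR V ℕ) (slice α V) i
  · rw [Finsupp.filter_apply_neg (fun x : ι × ℕ => x.1 = U) _ h,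
      Finsupp.embDomain_of_notMem_range]
    rintro ⟨j, hj⟩
    exact h (congrArg Prod.fst hj).symm

lemma fst_eq_of_coeff_inVars_ne_zero {U : ι} {f : MvPowerSeries ℕ ℤ} {α : ι × ℕ →₀ ℕ}
    (h : MvPowerSeries.coeff α (inVars U f) ≠ 0) {x : ι × ℕ} (hx : α x ≠ 0) : x.1 = U := by
  have hα : α ∈ Set.range (Finsupp.mapDomain (M := ℕ) (Function.Embedding.sectR U ℕ)) := by
    by_contra hn
    exact h (MvPowerSeries.coeff_rename_eq_zero _ _ hn)
  obtain ⟨a, rfl⟩ := hα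
  by_contra hne
  refine hx (Finsupp.mapDomain_of_notMem_range _ _ ?_)
  rintro ⟨j, rfl⟩
  exact hne rfl

open Classical in
lemma coeff_prod_inVars (S : Finset ι) (f : ι → MvPowerSeries ℕ ℤ) (α : ι × ℕ →₀ ℕ) :
    MvPowerSeries.coeff α (∏ U ∈ S, inVars U (f U)) =
      if ∀ x ∈ α.support, x.1 ∈ S then ∏ U ∈ S, MvPowerSeries.coeff (slice α U) (f U) else 0 := by
  induction S using Finset.induction_on generalizing α with
  | empty =>
    rw [Finset.prod_empty, Finset.prod_empty, MvPowerSeries.coeff_one]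
    refine if_congr ?_ rfl rfl
    rw [← Finsupp.support_eq_empty, Finset.eq_empty_iff_forall_notMem]
    simp only [Finset.notMem_empty]
  | insert V S hV ih =>
    have hsplit : (α.filter fun x => x.1 = V) + (α.filter fun x => ¬ x.1 = V) = α :=
      Finsupp.filter_add_filter_not α _
    -- The two factors involve disjoint sets of variables, so only one splitting of `α` can
    -- contribute.
    rw [Finset.prod_insert hV, MvPowerSeries.coeff_mul, Finset.sum_eq_single
      (α.filter fun x => x.1 = V, α.filter fun x => ¬ x.1 = V)]
    · simp only
      rw [← embDomain_slice, inVars, MvPowerSeries.coeff_embDomain_rename, ih,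
        Finset.prod_insert hV, mul_ite, mul_zero]
      refine if_congr ?_ ?_ rfl
      · simp only [Finsupp.support_filter, Finset.mem_filter, Finset.mem_insert]
        refine forall_congr' fun x => ?_
        tauto
      · congr 1
        refine Finset.prod_congr rfl fun U hU => ?_
        have hs : slice (α.filter fun x => ¬ x.1 = V) U = slice α U := by
          ext i
          rw [slice_apply, slice_apply, Finsupp.filter_apply_pos]
          rintro rfl
          exact hV hU
        rw [hs]
    · rintro ⟨p, q⟩ hpq hne
      rw [Finset.HasAntidiagonal.mem_antidiagonal] at hpq
      simp only at hpq ⊢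
      by_contra h
      have hp := left_ne_zero_of_mul h
      have hq := right_ne_zero_of_mul h
      rw [ih] at hq
      have hq' := (ite_ne_right_iff.1 hq).1
      refine hne ?_
      have key : ∀ x, (x.1 = V → q x = 0) ∧ (x.1 ≠ V → p x = 0) := by
        refine fun x => ⟨fun hx => ?_, fun hx => ?_⟩
        · by_contra hqx
          exact hV (hx ▸ hq' x (Finsupp.mem_support_iff.2 hqx))
        · by_contra hpx
          exact hx (fst_eq_of_coeff_inVars_ne_zero hp hpx)
      rw [← hpq]
      refine Prod.ext ?_ ?_
      · ext x
        by_cases hx : x.1 = V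
        · simp [hx, (key x).1 hx]
        · simp [hx, (key x).2 hx]
      · ext x
        by_cases hx : x.1 = V
        · simp [hx, (key x).1 hx]
        · simp [hx, (key x).2 hx]
    · intro h
      exact absurd (Finset.HasAntidiagonal.mem_antidiagonal.2 hsplit) h

namespace Multipartition

lemma ext_part {lam mu : Multipartition ι} (h : ∀ U, lam.part U = mu.part U) : lam = mu := by
  cases lam
  cases mu
  congr
  exact funext h

lemma card_eq_zero {lam : Multipartition ι} {U : ι} (h : U ∉ lam.finite_support.toFinset) :
    (lam.part U).card = 0 := by
  simpa using h

lemma coeff_schurProd (lam : Multipartition ι) (α : ι × ℕ →₀ ℕ) {S : Finset ι}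
    (hα : ∀ x ∈ α.support, x.1 ∈ S) (hlam : lam.finite_support.toFinset ⊆ S) :
    MvPowerSeries.coeff α (schurProd lam) =
      ∏ U ∈ S, MvPowerSeries.coeff (slice α U) (schur (lam.part U)) := by
  classical
  have h : schurProd lam = ∏ U ∈ S, inVars U (schur (lam.part U)) := by
    refine Finset.prod_subset hlam fun U _ hU => ?_
    rw [schur_eq_one (card_eq_zero hU), inVars, map_one]
  rw [h, coeff_prod_inVars S fun U => schur (lam.part U), if_pos hα]

lemma exists_finset (lam : Multipartition ι) (α : ι × ℕ →₀ ℕ) :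
    ∃ S : Finset ι, (∀ x ∈ α.support, x.1 ∈ S) ∧ lam.finite_support.toFinset ⊆ S := by
  classical
  exact ⟨α.support.image Prod.fst ∪ lam.finite_support.toFinset,
    fun x hx => Finset.mem_union_left _ (Finset.mem_image_of_mem _ hx),
    Finset.subset_union_right⟩

lemma coeff_slice_ne_zero {lam : Multipartition ι} {α : ι × ℕ →₀ ℕ}
    (h : MvPowerSeries.coeff α (schurProd lam) ≠ 0) (U : ι) :
    MvPowerSeries.coeff (slice α U) (schur (lam.part U)) ≠ 0 := by
  classical
  obtain ⟨S, hα, hlam⟩ := exists_finset lam α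
  rw [coeff_schurProd lam α hα hlam] at h
  by_cases hU : U ∈ S
  · exact Finset.prod_ne_zero_iff.1 h U hU
  · rw [schur_eq_one (card_eq_zero fun h => hU (hlam h)),
      slice_eq_zero (U := U) fun x hx hxU => hU (hxU ▸ hα x hx), MvPowerSeries.coeff_zero_one]
    exact one_ne_zero

/-- The exponent of the leading monomial of `schurProd lam`. -/
def leadingExponent (lam : Multipartition ι) : ι × ℕ →₀ ℕ :=
  ∑ U ∈ lam.finite_support.toFinset,
    (rowSeq (lam.part U)).embDomain (Function.Embedding.sectR U ℕ)

lemma rowSeq_eq_zero {μ : YoungDiagram} (h : μ.card = 0) : rowSeq μ = 0 := by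
  rw [← Finsupp.degree_eq_zero_iff, degree_rowSeq, h]

lemma slice_leadingExponent (lam : Multipartition ι) (U : ι) :
    slice lam.leadingExponent U = rowSeq (lam.part U) := by
  classical
  ext i
  rw [slice_apply, leadingExponent, Finsupp.finsetSum_apply]
  have h : ∀ V, V ≠ U → (rowSeq (lam.part V)).embDomain (Function.Embedding.sectR V ℕ) (U, i) = 0 := by
    intro V hV
    rw [Finsupp.embDomain_of_notMem_range]
    rintro ⟨j, hj⟩
    exact hV (congrArg Prod.fst hj)
  have h' : (rowSeq (lam.part U)).embDomain (Function.Embedding.sectR U ℕ) (U, i) =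
      rowSeq (lam.part U) i := Finsupp.embDomain_apply_self (Function.Embedding.sectR U ℕ) _ i
  rw [Finset.sum_eq_single U, h']
  · exact fun V _ hV => h V hV
  · intro hU
    rw [h', rowSeq_eq_zero (card_eq_zero hU)]
    rfl

lemma coeff_leadingExponent (lam : Multipartition ι) :
    MvPowerSeries.coeff lam.leadingExponent (schurProd lam) = 1 := by
  obtain ⟨S, hα, hlam⟩ := exists_finset lam lam.leadingExponent
  rw [coeff_schurProd lam _ hα hlam]
  exact Finset.prod_eq_one fun U _ => by rw [slice_leadingExponent, coeff_schur_rowSeq]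

/-- Comparison of multipartitions: equal sizes and rowwise lexicographic order. -/
def Rel (lam mu : Multipartition ι) : Prop :=
  ∀ U, (lam.part U).card = (mu.part U).card ∧
    toLex (lam.part U).rowLen ≤ toLex (mu.part U).rowLen

/-- A cell `(i, j)` forces `i + 1` cells in its column and `j + 1` in its row, so the diagram fits
in an `n × n` square. -/
lemma finite_youngDiagram (n : ℕ) : {μ : YoungDiagram | μ.card = n}.Finite := by
  refine Set.Finite.of_finite_image (f := YoungDiagram.cells)
    (((Finset.range n ×ˢ Finset.range n).powerset.finite_toSet).subset ?_)
    (fun μ _ ν _ h => YoungDiagram.ext h)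
  rintro _ ⟨μ, hμ, rfl⟩
  rw [Finset.mem_coe, Finset.mem_powerset]
  rintro ⟨i, j⟩ h
  have hμ' : μ.cells.card = n := hμ
  rw [Finset.mem_product, Finset.mem_range, Finset.mem_range]
  constructor
  · have : (Finset.range (i + 1)).image (fun k => (k, j)) ⊆ μ.cells := by
      intro c hc
      obtain ⟨k, hk, rfl⟩ := Finset.mem_image.1 hc
      exact μ.up_left_mem (Nat.lt_succ_iff.1 (Finset.mem_range.1 hk)) le_rfl h
    have := Finset.card_le_card this
    rw [Finset.card_image_of_injective _ (fun a b h => congrArg Prod.fst h), Finset.card_range] at this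
    omega
  · have : (Finset.range (j + 1)).image (fun k => (i, k)) ⊆ μ.cells := by
      intro c hc
      obtain ⟨k, hk, rfl⟩ := Finset.mem_image.1 hc
      exact μ.up_left_mem le_rfl (Nat.lt_succ_iff.1 (Finset.mem_range.1 hk)) h
    have := Finset.card_le_card this
    rw [Finset.card_image_of_injective _ (fun a b h => congrArg Prod.snd h), Finset.card_range] at this
    omega

lemma finite_card_eq {d : ι → ℕ} (hd : d.support.Finite) :
    {lam : Multipartition ι | ∀ U, (lam.part U).card = d U}.Finite := by
  have : Finite d.support := hd
  refine Set.Finite.of_finite_image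
    (f := fun lam (U : d.support) => lam.part U)
    ((Set.Finite.pi' fun U : d.support => finite_youngDiagram (d U)).subset ?_) ?_
  · rintro _ ⟨lam, hlam, rfl⟩ U
    exact hlam U
  · intro lam hlam mu hmu h
    refine ext_part fun U => ?_
    by_cases hU : d U = 0
    · have h₁ : (lam.part U).cells = ∅ := Finset.card_eq_zero.1 ((hlam U).trans hU)
      have h₂ : (mu.part U).cells = ∅ := Finset.card_eq_zero.1 ((hmu U).trans hU)
      exact YoungDiagram.ext (h₁.trans h₂.symm)
    · exact congrFun h ⟨U, hU⟩

lemma youngDiagram_eq_of_rowLen_eq {μ ν : YoungDiagram} (h : μ.rowLen = ν.rowLen) : μ = ν := by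
  refine YoungDiagram.ext (Finset.ext ?_)
  rintro ⟨i, j⟩
  rw [YoungDiagram.mem_cells, YoungDiagram.mem_cells, YoungDiagram.mem_iff_lt_rowLen,
    YoungDiagram.mem_iff_lt_rowLen, h]

/-- Since each `s_μ` is homogeneous, a nonzero entry forces equal sizes at every `U`; this makes the
upper sets finite even when `ι` is infinite. -/
lemma isUnitriangular : IsUnitriangular
    (fun lam mu : Multipartition ι => MvPowerSeries.coeff lam.leadingExponent (schurProd mu))
    Rel where
  diag := coeff_leadingExponent
  rel {lam mu} h U := by
    have hU := coeff_slice_ne_zero h U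
    rw [slice_leadingExponent] at hU
    exact ⟨by rw [← degree_rowSeq, degree_eq_of_coeff_schur_ne_zero hU],
      toLex_le_of_coeff_schur_ne_zero hU⟩
  trans h₁ h₂ U := ⟨(h₁ U).1.trans (h₂ U).1, (h₁ U).2.trans (h₂ U).2⟩
  antisymm h₁ h₂ := ext_part fun U =>
    youngDiagram_eq_of_rowLen_eq (toLex.injective (le_antisymm (h₁ U).2 (h₂ U).2))
  finite lam := (finite_card_eq lam.finite_support).subset fun _ h U => (h U).1.symm

lemma coeff_schurProd_embDomain (lam : Multipartition ι) (e : ι → Equiv.Perm ℕ)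
    (α : ι × ℕ →₀ ℕ) :
    MvPowerSeries.coeff (α.embDomain (Equiv.prodShear (Equiv.refl ι) e).toEmbedding)
      (schurProd lam) = MvPowerSeries.coeff α (schurProd lam) := by
  obtain ⟨S, hα, hlam⟩ := exists_finset lam α
  rw [coeff_schurProd lam α hα hlam, coeff_schurProd lam _ (S := S) ?_ hlam]
  · refine Finset.prod_congr rfl fun U _ => ?_
    have hs : slice (α.embDomain (Equiv.prodShear (Equiv.refl ι) e).toEmbedding) U =
        (slice α U).embDomain (e U).toEmbedding := by
      ext i
      obtain ⟨j, rfl⟩ := (e U).surjective i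
      exact (Finsupp.embDomain_apply_self (Equiv.prodShear (Equiv.refl ι) e).toEmbedding α
        (U, j)).trans (Finsupp.embDomain_apply_self (e U).toEmbedding (slice α U) j).symm
    rw [hs, coeff_embDomain_schur]
  · intro x hx
    rw [Finsupp.support_embDomain, Finset.mem_map] at hx
    obtain ⟨y, hy, rfl⟩ := hx
    exact hα y hy

/-- Sorting the exponents separately within each set of variables makes every monomial a leading
one. -/
lemma exists_perm_eq_leadingExponent (α : ι × ℕ →₀ ℕ) :
    ∃ (e : ι → Equiv.Perm ℕ) (lam : Multipartition ι),
      lam.leadingExponent.embDomain (Equiv.prodShear (Equiv.refl ι) e).toEmbedding = α := by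
  choose e μ h using fun U => exists_perm_eq_rowSeq (slice α U)
  have hfin : (Function.support fun U => (μ U).card).Finite := by
    refine (α.support.finite_toSet.image Prod.fst).subset fun U hU => ?_
    by_contra hn
    refine hU ?_
    simp only
    have h0 : slice α U = 0 := slice_eq_zero fun x hx hxU => hn ⟨x, hx, hxU⟩
    rw [← degree_rowSeq, ← Finsupp.degree_mapDomain (e U).toEmbedding,
      ← Finsupp.embDomain_eq_mapDomain, h, h0, map_zero]
  refine ⟨e, ⟨μ, hfin⟩, ?_⟩
  ext ⟨U, i⟩
  obtain ⟨j, rfl⟩ := (e U).surjective i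
  refine (Finsupp.embDomain_apply_self (Equiv.prodShear (Equiv.refl ι) e).toEmbedding _
    (U, j)).trans ?_
  rw [← slice_apply, slice_leadingExponent, ← slice_apply, ← h U]
  exact (Finsupp.embDomain_apply_self (e U).toEmbedding _ j).symm

end Multipartition

/-! ### Existence, uniqueness and the span of the family -/

lemma isZFamily_iff (b : Module.Basis ι ℤ R) (Z : Multipartition ι → GQ R) :
    IsZFamily b Z ↔ ∀ lam : Multipartition ι, ∑ᶠ mu : Multipartition ι,
      MvPowerSeries.coeff lam.leadingExponent (schurProd mu) • Z mu =
        MvPowerSeries.coeff lam.leadingExponent (genFun b) := by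
  refine ⟨fun h lam => h _, fun h α => ?_⟩
  obtain ⟨e, lam, rfl⟩ := Multipartition.exists_perm_eq_leadingExponent α
  simp only [Multipartition.coeff_schurProd_embDomain]
  rw [coeff_genFun_embDomain b _ fun _ => rfl, h]

lemma existsUnique_isZFamily (b : Module.Basis ι ℤ R) :
    ∃! Z : Multipartition ι → GQ R, IsZFamily b Z := by
  obtain ⟨Z, hZ⟩ := Multipartition.isUnitriangular.exists_solution
    fun lam : Multipartition ι => MvPowerSeries.coeff lam.leadingExponent (genFun b)
  refine ⟨Z, (isZFamily_iff b Z).2 hZ, fun Z' hZ' => ?_⟩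
  exact Multipartition.isUnitriangular.solution_unique fun lam =>
    ((isZFamily_iff b Z').1 hZ' lam).trans (hZ lam).symm

lemma integralForm_toAddSubgroup (b : Module.Basis ι ℤ R) {Z : Multipartition ι → GQ R}
    (hZ : IsZFamily b Z) : (integralForm Z).toAddSubgroup = coeffGroup b := by
  rw [integralForm, Submodule.span_int_eq_addSubgroupClosure]
  refine le_antisymm ((AddSubgroup.closure_le _).2 ?_) ((AddSubgroup.closure_le _).2 ?_)
  · rintro _ ⟨lam, rfl⟩
    refine Multipartition.isUnitriangular.solution_mem (coeffGroup b) (fun lam => ?_) lam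
    rw [(isZFamily_iff b Z).1 hZ lam]
    exact coeff_genFun_mem b _
  · rintro _ ⟨α, rfl⟩
    simp only
    rw [← hZ α]
    -- No finiteness is needed here, as a `finsum` with infinite support is `0`.
    exact finsum_induction (· ∈ AddSubgroup.closure (Set.range Z)) (zero_mem _)
      (fun _ _ => add_mem) fun lam => zsmul_mem (AddSubgroup.subset_closure (Set.mem_range_self lam)) _

end LimitGrothendieck

end

theorem theorem4p6 {R : Type*} [Ring R] {ι ι' : Type*}
    (b : Module.Basis ι ℤ R) (b' : Module.Basis ι' ℤ R) :
    (∃! Z : LimitGrothendieck.Multipartition ι → LimitGrothendieck.GQ R,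
      LimitGrothendieck.IsZFamily b Z) ∧
    (∃! Z' : LimitGrothendieck.Multipartition ι' → LimitGrothendieck.GQ R,
      LimitGrothendieck.IsZFamily b' Z') ∧
    ∀ (Z : LimitGrothendieck.Multipartition ι → LimitGrothendieck.GQ R)
      (Z' : LimitGrothendieck.Multipartition ι' → LimitGrothendieck.GQ R),
      LimitGrothendieck.IsZFamily b Z → LimitGrothendieck.IsZFamily b' Z' →
        LimitGrothendieck.integralForm Z = LimitGrothendieck.integralForm Z' := by
  refine ⟨LimitGrothendieck.existsUnique_isZFamily b, LimitGrothendieck.existsUnique_isZFamily b',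
    fun Z Z' hZ hZ' => Submodule.toAddSubgroup_injective ?_⟩
  rw [LimitGrothendieck.integralForm_toAddSubgroup b hZ,
    LimitGrothendieck.integralForm_toAddSubgroup b' hZ', LimitGrothendieck.coeffGroup_eq b b']
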